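/- All signatures are finite and relational; a structure is identified with its set of atoms, a database instance is a finite structure, a query is a Boolean conjunctive query in which every variable occurs in an atom. A (Datalog$^\exists$) program $\mathcal T$ is a finite set of datalog rules $\forall\bar x\,(\Psi(\bar x)\Rightarrow Q(\bar y))$ and single-head TGDs $\forall\bar x\,(\Psi(\bar x)\Rightarrow\exists y\,Q(y,\bar y))$, where $\Psi$ is a (possibly empty) conjunction of atoms in which all of $\bar x$ occur and $\bar y\subseteq\bar x$. It is guarded if the body of each of its rules (datalog rules and TGDs) has an atom containing all variables of that body. $\mathcal T,D\models\Phi$ (resp. $\mathcal T,D\models_{\rm fin}\Phi$) means that $\Phi$ holds in every structure (resp. every finite structure) that contains $D$ and satisfies $\mathcal T$. $\mathcal T$ is finitely controllable (FC) if for every database instance $D$ and query $\Phi$ with $\mathcal T,D\not\models\Phi$ there is a finite structure that contains $D$, satisfies $\mathcal T$, and does not satisfy $\Phi$. $Chase(D,\mathcal T)$ is the non-oblivious chase (all rules are applied in parallel, a new witness for a TGD being created only if none exists), and $Chase(\mathcal T)=Chase(\emptyset,\mathcal T)$. For a structure over a signature with unary and binary relations only, let $\mathcal P(e)$ consist of $e$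 and of all $d$ such that $R(d,e)$ holds for some binary $R$. The structure is a Very Treelike DAG (VTDAG) if its graph of binary atoms has no directed cycle, for each binary $R$ and each $e$ there is at most one $d$ with $R(d,e)$, and for all $e$ and $d,d'\in\mathcal P(e)$ we have $d\in\mathcal P(d')$ or $d'\in\mathcal P(d)$. For a structure $C$ and an element $e$, the positive $n$-type $ptp_n(C,e)$ is the set of conjunctive queries $\exists\bar x\,\Psi(\bar x,y)$ with $|\bar x|<n$ that are true in $C$ at $y=e$. $M_n(C)$ is the quotient of $C$ by equality of positive $n$-types, with the least relations for which the quotient map $q_n$ is a homomorphism. A coloring $\bar C$ of a $\Sigma$-structure $C$ adds finitely many unary relations (colors) such that each element has exactly one color; $\bar C$ is $n$-conservative up to size $m$ if, for each $e\in C$, the positive $m$-types over $\Sigma$ of $e$ in $C$ and of $q_n(e)$ in $M_n(\bar C)$ are equal. Theorem. Let $\Sigma$ be a finite relational signature. 1. For every guarded Datalog$^\exists$ program $\mathcal T$ over $\Sigma$ and every database instance $D$ over $\Sigma$ there are a finite signature $\Sigma'$ consisting of unary and binary relations, a Datalog$^\exists$ program $\mathcal T'$ over $\Sigma'$, and, for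 each relation $R$ of $\Sigma$, a union of conjunctive queries $V_R$ over $\Sigma'$ with as many answer variables as $R$ has arguments, such that $Chase(\mathcal T')$ is a VTDAG and, for every query $\Phi$ over $\Sigma$, with $\Phi'$ being the result of replacing in $\Phi$ each relation $R$ by its view $V_R$: $Chase(D,\mathcal T)\models\Phi$ if and only if $Chase(\mathcal T')\models\Phi'$; $\mathcal T,D\models\Phi$ if and only if $\mathcal T'\models\Phi'$; and $\mathcal T,D\models_{\rm fin}\Phi$ if and only if $\mathcal T'\models_{\rm fin}\Phi'$. 2. Let $\bar C$ be a coloring of a $\Sigma$-structure $C$ that is $n$-conservative up to size $m$. Then every datalog rule over $\Sigma$ with at most $m$ variables and a unary relation in the head that is true in $C$ is true in $M_n(\bar C)$. 3. Every guarded Datalog$^\exists$ program over $\Sigma$ is FC. -/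

import Mathlib

/-! Relational signatures, atoms and structures.  A structure (or database instance) over a
signature `S` with elements taken from a type `A` is its set of atoms, `Set (Atom S A)`. -/

/-- A relational signature. -/
structure Signature where
  Rel : Type
  arity : Rel → ℕ

/-- A binary signature: every relation is unary or binary. -/
def Signature.IsBinary (S : Signature) : Prop :=
  ∀ R : S.Rel, S.arity R = 1 ∨ S.arity R = 2

/-- Atoms whose arguments are taken from `V`: atomic formulas if `V` consists of variables,
facts if `V` consists of elements of a structure. -/
structure Atom (S : Signature) (V : Type) where
  rel : S.Rel
  args : Fin (S.arity rel) → V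

/-- Replace every argument of an atom by its image. -/
def Atom.map {S : Signature} {V W : Type} (f : V → W) (a : Atom S V) : Atom S W :=
  ⟨a.rel, fun i => f (a.args i)⟩

/-- A conjunction of finitely many atoms in the variables `0, …, n - 1`, each of which occurs. -/
structure CQ (S : Signature) where
  n : ℕ
  atoms : List (Atom S (Fin n))
  occurs : ∀ x : Fin n, ∃ a ∈ atoms, ∃ i, a.args i = x

/-- The valuation `v` makes all the atoms of the query true in `I`. -/
def CQ.SatBy {S : Signature} {A : Type} (Q : CQ S) (I : Set (Atom S A)) (v : Fin Q.n → A) : Prop :=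
  ∀ a ∈ Q.atoms, a.map v ∈ I

/-- The Boolean query (all variables quantified existentially) is true in `I`. -/
def CQ.Holds {S : Signature} {A : Type} (Q : CQ S) (I : Set (Atom S A)) : Prop :=
  ∃ v, Q.SatBy I v

/-- A plain datalog rule `∀ x̄ (Ψ(x̄) ⇒ Q(ȳ))` with `ȳ ⊆ x̄`. -/
structure DatalogRule (S : Signature) where
  body : CQ S
  head : Atom S (Fin body.n)

/-- A (single-head) existential TGD `∀ x̄ (Ψ(x̄) ⇒ ∃ y Q(y, ȳ))` with `ȳ ⊆ x̄`.
In the head, `none` is the variable `y`. -/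
structure TGD (S : Signature) where
  body : CQ S
  head : Atom S (Option (Fin body.n))
  exists_occurs : ∃ i, head.args i = none

/-- A Datalog∃ program (theory): finitely many datalog rules and existential TGDs. -/
structure Theory (S : Signature) where
  rules : Finset (DatalogRule S)
  tgds : Finset (TGD S)

def DatalogRule.TrueIn {S : Signature} {A : Type} (r : DatalogRule S) (I : Set (Atom S A)) : Prop :=
  ∀ v, r.body.SatBy I v → r.head.map v ∈ I

/-- The head of a TGD under the valuation `v` of the variables of the body, with witness `y`. -/
def TGD.headWith {S : Signature} {A : Type} (t : TGD S) (v : Fin t.body.n → A) (y : A) : Atom S A :=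
  t.head.map (fun o => o.elim y v)

def TGD.TrueIn {S : Signature} {A : Type} (t : TGD S) (I : Set (Atom S A)) : Prop :=
  ∀ v, t.body.SatBy I v → ∃ y, t.headWith v y ∈ I

/-- `I ⊨ T`. -/
def Theory.TrueIn {S : Signature} {A : Type} (T : Theory S) (I : Set (Atom S A)) : Prop :=
  (∀ r ∈ T.rules, r.TrueIn I) ∧ ∀ t ∈ T.tgds, t.TrueIn I

/-- `I ⊨ D`: the elements of `D` are (distinct) elements of `I` via `ι`, and each atom of `D`
is an atom of `I`. -/
def Contains {S : Signature} {A M : Type} (I : Set (Atom S M)) (D : Set (Atom S A)) : Prop :=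
  ∃ ι : A ↪ M, ∀ a ∈ D, a.map ι ∈ I

/-- `T, D ⊨ Φ`: the query is true in all structures containing `D` and satisfying `T`. -/
def Theory.Entails {S : Signature} {A : Type} (T : Theory S) (D : Set (Atom S A)) (Φ : CQ S) :
    Prop :=
  ∀ (M : Type) (I : Set (Atom S M)), Contains I D → T.TrueIn I → Φ.Holds I

/-- The query is true in all finite structures containing `D` and satisfying `T`. -/
def Theory.FinEntails {S : Signature} {A : Type} (T : Theory S) (D : Set (Atom S A)) (Φ : CQ S) :
    Prop :=
  ∀ (M : Type) [Finite M] (I : Set (Atom S M)), Contains I D → T.TrueIn I → Φ.Holds I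

/-- Finite controllability: for each (finite) database instance `D` and each query `Φ` with
`T, D ⊭ Φ` there is a finite structure satisfying `D` and `T` but not `Φ`. -/
def Theory.IsFC {S : Signature} (T : Theory S) : Prop :=
  ∀ (A : Type) [Finite A] (D : Set (Atom S A)) (Φ : CQ S), ¬ T.Entails D Φ →
    ∃ (M : Type) (_ : Finite M) (I : Set (Atom S M)), Contains I D ∧ T.TrueIn I ∧ ¬ Φ.Holds I

/-- Some atom of the conjunction (the guard) contains all its variables. -/
def CQ.IsGuarded {S : Signature} (Q : CQ S) : Prop :=
  ∃ g ∈ Q.atoms, ∀ x : Fin Q.n, ∃ i, g.args i = x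

/-- A guarded Datalog∃ program: the body of each datalog rule and of each TGD has a guard. -/
def Theory.IsGuarded {S : Signature} (T : Theory S) : Prop :=
  (∀ r ∈ T.rules, r.body.IsGuarded) ∧ ∀ t ∈ T.tgds, t.body.IsGuarded

/-! The (non-oblivious) chase. -/

/-- Elements of the chase: those of the initial instance, and the witness `c_{t, x̄}` for each
TGD `t` and each tuple `x̄`. (Only those which occur in atoms of the chase matter.) -/
inductive ChaseElem (S : Signature) (A : Type) : Type where
  | base (a : A) : ChaseElem S A
  | witness (t : TGD S) (v : Fin t.body.n → ChaseElem S A) : ChaseElem S A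

/-- One parallel step of the chase: all the consequences of datalog rules are added, and
wherever the body of a TGD holds and no witness exists a new one is created. -/
def Theory.chaseStep {S : Signature} {A : Type} (T : Theory S)
    (I : Set (Atom S (ChaseElem S A))) : Set (Atom S (ChaseElem S A)) :=
  I ∪ {f | ∃ r ∈ T.rules, ∃ v, r.body.SatBy I v ∧ f = r.head.map v}
    ∪ {f | ∃ t ∈ T.tgds, ∃ v, t.body.SatBy I v ∧ (¬ ∃ y, t.headWith v y ∈ I) ∧
        f = t.headWith v (ChaseElem.witness t v)}

def Theory.chaseN {S : Signature} {A : Type} (T : Theory S) (D : Set (Atom S A)) :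
    ℕ → Set (Atom S (ChaseElem S A))
  | 0 => Atom.map ChaseElem.base '' D
  | i + 1 => T.chaseStep (T.chaseN D i)

/-- `Chase(D, T)`. -/
def Theory.chase {S : Signature} {A : Type} (T : Theory S) (D : Set (Atom S A)) :
    Set (Atom S (ChaseElem S A)) :=
  ⋃ i, T.chaseN D i

/-- The chase of a program that starts from the empty database instance. -/
def Theory.chaseEmpty {S : Signature} (T : Theory S) : Set (Atom S (ChaseElem S Empty)) :=
  T.chase ∅

/-! Very treelike DAGs (over signatures without constants). -/

/-- `R(d, e)` is an atom of `I`, where `R` is a binary relation. -/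
def Edge {S : Signature} {A : Type} (I : Set (Atom S A)) (R : S.Rel) (d e : A) : Prop :=
  S.arity R = 2 ∧ (⟨R, fun i => if i.val = 0 then d else e⟩ : Atom S A) ∈ I

/-- `𝒫(e)`: the element `e` with all its direct predecessors. -/
def preds {S : Signature} {A : Type} (I : Set (Atom S A)) (e : A) : Set A :=
  {d | d = e ∨ ∃ R, Edge I R d e}

structure IsVTDAG {S : Signature} {A : Type} (I : Set (Atom S A)) : Prop where
  acyclic : ∀ a, ¬ Relation.TransGen (fun d e => ∃ R, Edge I R d e) a a
  unique_pred : ∀ (R : S.Rel) (e d d' : A), Edge I R d e → Edge I R d' e → d = d'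
  clique : ∀ e, ∀ d ∈ preds I e, ∀ d' ∈ preds I e, d ∈ preds I d' ∨ d' ∈ preds I d

/-! Views: each relation of `S` is defined by a union of conjunctive queries over `S'`. -/

/-- A conjunctive query with `k` answer variables (the others are existentially quantified). -/
structure AnswerCQ (S : Signature) (k : ℕ) where
  query : CQ S
  out : Fin k → Fin query.n

/-- For each relation of `S`, a finite disjunction of conjunctive queries over `S'`. -/
def Views (S S' : Signature) : Type :=
  ∀ R : S.Rel, List (AnswerCQ S' (S.arity R))

/-- The structure over `S` with the same elements whose relations are the views. -/
def Views.apply {S S' : Signature} {A : Type} (V : Views S S') (I : Set (Atom S' A)) :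
    Set (Atom S A) :=
  {f | ∃ q ∈ V f.rel, ∃ v, q.query.SatBy I v ∧ ∀ i, f.args i = v (q.out i)}

/-! Positive types, colorings, quotients. -/

/-- A conjunctive query `Ψ(x̄, y)` with `k = |x̄|`; `none` is the variable `y`. -/
structure TypeQuery (S : Signature) where
  k : ℕ
  atoms : List (Atom S (Option (Fin k)))

/-- The positive `n`-type of the element `e`. -/
def ptp {S : Signature} {A : Type} (n : ℕ) (I : Set (Atom S A)) (e : A) : Set (TypeQuery S) :=
  {Ψ | Ψ.k < n ∧ ∃ v : Fin Ψ.k → A, ∀ a ∈ Ψ.atoms, a.map (fun o => o.elim e v) ∈ I}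

/-- `d ≡ₙ e`. -/
def ptpSetoid {S : Signature} {A : Type} (n : ℕ) (I : Set (Atom S A)) : Setoid A :=
  Setoid.ker (ptp n I)

/-- The atoms of the quotient `Mₙ(I)`, whose elements are the classes of `≡ₙ`. -/
def quotientStructure {S : Signature} {A : Type} (n : ℕ) (I : Set (Atom S A)) :
    Set (Atom S (Quotient (ptpSetoid n I))) :=
  Atom.map (Quotient.mk (ptpSetoid n I)) '' I

/-- The signature `S` with finitely many colors added as unary relations; a color is a pair
(hue, lightness). -/
def Signature.withColors (S : Signature) (K : Finset (ℕ × ℕ)) : Signature where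
  Rel := S.Rel ⊕ K
  arity := Sum.elim S.arity (fun _ => 1)

/-- The coloring of `I` in which `col a` is the unique color of the element `a`. -/
def colored {S : Signature} {A : Type} {K : Finset (ℕ × ℕ)} (I : Set (Atom S A)) (col : A → K) :
    Set (Atom (S.withColors K) A) :=
  {f | (∃ a ∈ I, f = ⟨Sum.inl a.rel, a.args⟩) ∨ ∃ x, f = ⟨Sum.inr (col x), fun _ => x⟩}

/-- The restriction of a structure to the signature without the colors. -/
def uncolored {S : Signature} {A : Type} {K : Finset (ℕ × ℕ)}
    (J : Set (Atom (S.withColors K) A)) : Set (Atom S A) :=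
  {a | (⟨Sum.inl a.rel, a.args⟩ : Atom (S.withColors K) A) ∈ J}

/-- The coloring of `I` given by `col` is `n`-conservative up to size `m`: the positive `m`-types
over `S` of all elements are preserved by the quotient map to `Mₙ` of the coloring. -/
def IsConservative {S : Signature} {A : Type} {K : Finset (ℕ × ℕ)} (n m : ℕ)
    (I : Set (Atom S A)) (col : A → K) : Prop :=
  ∀ e : A, ptp m I e =
    ptp m (uncolored (quotientStructure n (colored I col))) (Quotient.mk _ e)

/-! Rewriting and finite controllability rest on a tree of bags. A bag is a tuple of elements
indexed by a fixed finite set of positions; a child bag arises by firing a TGD and keeps chosen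
elements of its parent. The label of a bag records the equalities and every atom entailed, in models
of `T`, by the atoms known at its creation. It depends only on the parent's label and the kind of
step, so equal labels carry equal subtrees (`label_append`). A child says nothing new about its
parent's elements, since in a model every tuple realizing the parent's label extends to the child
(`Fits.exists_step`, `mem_label_cons_iff`).

The tree folds to a finite structure: color its elements so that each differs from all others
reached from it by short walks through bags, then identify elements whose color, label and, to a
bounded depth, bags look alike. By guardedness a rule body true in the quotient sits in one bag, so
the quotient is a model (`foldedTree_trueIn`). A query true in it lifts back to the tree: properness
forbids short cycles, so its elements can be placed one after another by moving subtrees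
(`exists_lift`). Thus finite entailment implies truth in the tree.

The binary program describes bags as single elements with edges from their members. The tree maps
into the view of each of its models (`exists_hom_of_isTreeModel`), and each model of `T` and `D`
yields a model of it, made of tuples, whose view satisfies no more queries (`exists_isTreeModel`).
Hence truth in the tree and all four entailments coincide. In its chase the edges raise a weight,
and the predecessors of a child are among the parent and the parent's predecessors, which gives a
VTDAG.

A rule with a unary head only concerns the positive type of one element, which conservativity
preserves. -/

theorem Atom.map_map {S : Signature} {U V W : Type} (f : U → V) (g : V → W) (a : Atom S U) :
    (a.map f).map g = a.map (g ∘ f) := rfl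

theorem Atom.map_congr {S : Signature} {V W : Type} {f g : V → W} {a : Atom S V}
    (h : ∀ i, f (a.args i) = g (a.args i)) : a.map f = a.map g := by
  cases a
  simp only [Atom.map, Atom.mk.injEq, heq_eq_eq, true_and]
  exact funext h

theorem Atom.exists_args_of_map_eq {S : Signature} {U V W : Type} {f : U → W} {g : V → W}
    {a : Atom S U} {b : Atom S V} (h : a.map f = b.map g) :
    ∃ args : Fin (S.arity b.rel) → U, a = ⟨b.rel, args⟩ ∧ ∀ i, f (args i) = g (b.args i) := by
  rcases a with ⟨R, x⟩
  rcases b with ⟨R', y⟩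
  simp only [Atom.map, Atom.mk.injEq] at h
  obtain ⟨rfl, h⟩ := h
  exact ⟨x, rfl, fun i => congrFun (eq_of_heq h) i⟩

instance Atom.instFinite {S : Signature} [Finite S.Rel] {V : Type} [Finite V] :
    Finite (Atom S V) :=
  Finite.of_injective (β := Σ R : S.Rel, (Fin (S.arity R) → V)) (fun a => ⟨a.rel, a.args⟩) (by
    rintro ⟨R, x⟩ ⟨R', y⟩ h
    simp only [Sigma.mk.injEq] at h
    obtain ⟨rfl, h⟩ := h
    rw [eq_of_heq h])

theorem CQ.Holds.map {S : Signature} {A B : Type} {I : Set (Atom S A)} {J : Set (Atom S B)}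
    (h : A → B) (hIJ : ∀ a ∈ I, a.map h ∈ J) {Φ : CQ S} (hΦ : Φ.Holds I) : Φ.Holds J := by
  obtain ⟨v, hv⟩ := hΦ
  exact ⟨h ∘ v, fun a ha => hIJ _ (hv a ha)⟩

theorem Views.map_mem_apply {S S' : Signature} (V : Views S S') {A B : Type}
    {I : Set (Atom S' A)} {J : Set (Atom S' B)} (h : A → B) (hIJ : ∀ a ∈ I, a.map h ∈ J) :
    ∀ a ∈ V.apply I, a.map h ∈ V.apply J := by
  rintro a ⟨q, hq, v, hv, hav⟩
  exact ⟨q, hq, h ∘ v, fun b hb => hIJ _ (hv b hb), fun i => congrArg h (hav i)⟩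

theorem TGD.headWith_map {S : Signature} {A B : Type} (t : TGD S) (v : Fin t.body.n → A) (y : A)
    (h : A → B) : (t.headWith v y).map h = t.headWith (h ∘ v) (h y) := by
  unfold TGD.headWith
  rw [Atom.map_map]
  exact Atom.map_congr fun i => by
    simp only [Function.comp]
    cases t.head.args i <;> rfl

/-! Adding an isolated element. -/

/-- Every variable occurs in an atom, so none can take the isolated value `none`. The added element
makes the domain nonempty without affecting queries or rules. -/
theorem exists_comp_some {S : Signature} {Q : CQ S} {M : Type} {I : Set (Atom S M)}
    {v : Fin Q.n → Option M} (hv : Q.SatBy (Atom.map some '' I) v) :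
    ∃ w, v = some ∘ w ∧ Q.SatBy I w := by
  have key : ∀ x, ∃ y, v x = some y := by
    intro x
    obtain ⟨a, ha, i, rfl⟩ := Q.occurs x
    obtain ⟨b, -, hb⟩ := hv a ha
    obtain ⟨args, -, h⟩ := Atom.exists_args_of_map_eq hb
    exact ⟨_, (h i).symm⟩
  choose w hw using key
  obtain rfl : v = some ∘ w := funext hw
  refine ⟨w, rfl, fun a ha => ?_⟩
  obtain ⟨b, hbI, hb⟩ := hv a ha
  obtain ⟨args, rfl, h⟩ := Atom.exists_args_of_map_eq hb
  have : args = w ∘ a.args := funext fun i => Option.some_injective _ (h i)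
  subst this
  exact hbI

theorem CQ.holds_of_holds_some {S : Signature} {Φ : CQ S} {M : Type} {I : Set (Atom S M)}
    (h : Φ.Holds (Atom.map some '' I)) : Φ.Holds I := by
  obtain ⟨v, hv⟩ := h
  obtain ⟨w, -, hw⟩ := exists_comp_some hv
  exact ⟨w, hw⟩

theorem Theory.TrueIn.image_some {S : Signature} {T : Theory S} {M : Type} {I : Set (Atom S M)}
    (h : T.TrueIn I) : T.TrueIn (Atom.map some '' I) := by
  refine ⟨fun r hr v hv => ?_, fun t ht v hv => ?_⟩
  · obtain ⟨w, rfl, hw⟩ := exists_comp_some hv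
    exact ⟨_, h.1 r hr w hw, rfl⟩
  · obtain ⟨w, rfl, hw⟩ := exists_comp_some hv
    obtain ⟨y, hy⟩ := h.2 t ht w hw
    exact ⟨some y, _, hy, TGD.headWith_map t w y some⟩

theorem Contains.image_some {S : Signature} {A M : Type} {I : Set (Atom S M)}
    {D : Set (Atom S A)} (h : Contains I D) : Contains (Atom.map some '' I) D := by
  obtain ⟨ι, hι⟩ := h
  exact ⟨ι.trans Function.Embedding.some, fun a ha => ⟨_, hι a ha, rfl⟩⟩

/-! The chase is a universal model. -/

theorem Theory.chaseN_mono {S : Signature} {A : Type} (T : Theory S) (D : Set (Atom S A)) :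
    Monotone (T.chaseN D) :=
  monotone_nat_of_le_succ fun _ _ ha => Or.inl (Or.inl ha)

theorem Theory.satBy_chase {S : Signature} {A : Type} {T : Theory S} {D : Set (Atom S A)}
    {Q : CQ S} {v : Fin Q.n → ChaseElem S A} (h : Q.SatBy (T.chase D) v) :
    ∃ i, Q.SatBy (T.chaseN D i) v := by
  have key : ∀ l : List (Atom S (Fin Q.n)), (∀ a ∈ l, a.map v ∈ T.chase D) →
      ∃ i, ∀ a ∈ l, a.map v ∈ T.chaseN D i := by
    intro l
    induction l with
    | nil => exact fun _ => ⟨0, by simp⟩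
    | cons a l ih =>
      intro hl
      obtain ⟨i, hi⟩ := ih fun b hb => hl b (List.mem_cons_of_mem _ hb)
      obtain ⟨j, hj⟩ := Set.mem_iUnion.1 (hl a List.mem_cons_self)
      refine ⟨max i j, fun b hb => ?_⟩
      rcases List.mem_cons.1 hb with rfl | hb
      · exact T.chaseN_mono D (le_max_right i j) hj
      · exact T.chaseN_mono D (le_max_left i j) (hi b hb)
  exact key _ h

theorem Theory.chase_trueIn {S : Signature} {A : Type} (T : Theory S) (D : Set (Atom S A)) :
    T.TrueIn (T.chase D) := by
  refine ⟨fun r hr v hv => ?_, fun t ht v hv => ?_⟩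
  · obtain ⟨i, hi⟩ := Theory.satBy_chase hv
    exact Set.mem_iUnion.2 ⟨i + 1, Or.inl (Or.inr ⟨r, hr, v, hi, rfl⟩)⟩
  · obtain ⟨i, hi⟩ := Theory.satBy_chase hv
    by_cases hy : ∃ y, t.headWith v y ∈ T.chaseN D i
    · obtain ⟨y, hy⟩ := hy
      exact ⟨y, Set.mem_iUnion.2 ⟨i, hy⟩⟩
    · exact ⟨_, Set.mem_iUnion.2 ⟨i + 1, Or.inr ⟨t, ht, v, hi, hy, rfl⟩⟩⟩

theorem Theory.chase_contains {S : Signature} {A : Type} (T : Theory S) (D : Set (Atom S A)) :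
    Contains (T.chase D) D :=
  ⟨⟨ChaseElem.base, fun _ _ h => ChaseElem.base.inj h⟩,
    fun a ha => Set.mem_iUnion.2 ⟨0, a, ha, rfl⟩⟩

open Classical in
/-- The interpretation in a model of the elements of the chase. -/
noncomputable def ChaseElem.interp {S : Signature} {A M : Type} [Nonempty M] (I : Set (Atom S M))
    (f : A → M) : ChaseElem S A → M
  | .base a => f a
  | .witness t v =>
    if h : ∃ y, t.headWith (fun i => (v i).interp I f) y ∈ I then h.choose
    -- A junk value, never reached on elements created by the chase of a program that is true in
    -- `I`.
    else Classical.arbitrary M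

theorem Theory.chase_interp {S : Signature} {A M : Type} [Nonempty M] {T : Theory S}
    {D : Set (Atom S A)} {I : Set (Atom S M)} {f : A → M} (hD : ∀ a ∈ D, a.map f ∈ I)
    (hT : T.TrueIn I) : ∀ a ∈ T.chase D, a.map (ChaseElem.interp I f) ∈ I := by
  intro a ha
  obtain ⟨i, hi⟩ := Set.mem_iUnion.1 ha
  clear ha
  induction i generalizing a with
  | zero =>
    obtain ⟨b, hb, rfl⟩ := hi
    exact hD b hb
  | succ i ih =>
    rcases hi with (hi | ⟨r, hr, v, hv, rfl⟩) | ⟨t, ht, v, hv, -, rfl⟩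
    · exact ih a hi
    · exact hT.1 r hr (ChaseElem.interp I f ∘ v) fun b hb => ih _ (hv b hb)
    · have h := hT.2 t ht (ChaseElem.interp I f ∘ v) fun b hb => ih _ (hv b hb)
      rw [TGD.headWith_map]
      have h' : ∃ y, t.headWith (fun i => (v i).interp I f) y ∈ I := h
      rw [ChaseElem.interp, dif_pos h']
      exact h'.choose_spec

theorem Theory.entails_iff_chase {S : Signature} {A : Type} (T : Theory S) (D : Set (Atom S A))
    (Φ : CQ S) : T.Entails D Φ ↔ Φ.Holds (T.chase D) := by
  refine ⟨fun h => h _ _ (T.chase_contains D) (T.chase_trueIn D), fun h M I hD hT => ?_⟩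
  obtain ⟨ι, hι⟩ := hD.image_some
  exact CQ.holds_of_holds_some (h.map _ (Theory.chase_interp hι hT.image_some))

/-- Every atom of the chase of the empty instance is the head of a rule or of a TGD. -/
theorem Theory.chaseEmpty_cases {S : Signature} {T : Theory S} {f : Atom S (ChaseElem S Empty)}
    (hf : f ∈ T.chaseEmpty) :
    (∃ r ∈ T.rules, ∃ v, r.body.SatBy T.chaseEmpty v ∧ f = r.head.map v) ∨
      ∃ t ∈ T.tgds, ∃ v, t.body.SatBy T.chaseEmpty v ∧
        f = t.headWith v (ChaseElem.witness t v) := by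
  obtain ⟨i, hi⟩ := Set.mem_iUnion.1 hf
  clear hf
  induction i with
  | zero =>
    obtain ⟨b, hb, -⟩ := hi
    exact hb.elim
  | succ i ih =>
    have hsub : T.chaseN (∅ : Set (Atom S Empty)) i ⊆ T.chaseEmpty :=
      Set.subset_iUnion (T.chaseN (∅ : Set (Atom S Empty))) i
    rcases hi with (hi | ⟨r, hr, v, hv, rfl⟩) | ⟨t, ht, v, hv, -, rfl⟩
    · exact ih hi
    · exact Or.inl ⟨r, hr, v, fun b hb => hsub (hv b hb), rfl⟩
    · exact Or.inr ⟨t, ht, v, fun b hb => hsub (hv b hb), rfl⟩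

/-! Datalog rules with unary heads in conservative quotients. -/

/-- With the head variable left free, the body is a query in the positive `m`-type of one class.
Conservativity moves it to a representative, where the rule applies. -/
theorem DatalogRule.trueIn_quotient {S : Signature} {A : Type} {I : Set (Atom S A)}
    {K : Finset (ℕ × ℕ)} {col : A → K} {n m : ℕ} (hc : IsConservative n m I col)
    (r : DatalogRule S) (hr : S.arity r.head.rel = 1) (hm : r.body.n ≤ m) (hI : r.TrueIn I) :
    r.TrueIn (uncolored (quotientStructure n (colored I col))) := by
  intro v hv
  have hargs : ∀ i j, r.head.args i = r.head.args j := by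
    intro i j
    congr 1
    have := i.2
    have := j.2
    exact Fin.ext (by omega)
  let i₀ : Fin (S.arity r.head.rel) := ⟨0, by omega⟩
  obtain ⟨k, hk⟩ : ∃ k, r.body.n = k + 1 := by
    have := (r.head.args i₀).2
    exact ⟨r.body.n - 1, by omega⟩
  -- Splits off the head variable as the free variable of the type; the `k = r.body.n - 1 < m`
  -- others stay quantified.
  let ε : Fin r.body.n ≃ Option (Fin k) :=
    (finCongr hk).trans (finSuccEquiv' (finCongr hk (r.head.args i₀)))
  have hε : ε (r.head.args i₀) = none := by simp [ε]
  obtain ⟨e, he⟩ := Quotient.exists_rep (v (r.head.args i₀))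
  let Ψ : TypeQuery S := ⟨k, r.body.atoms.map (Atom.map ε)⟩
  have hΨ : Ψ ∈ ptp m (uncolored (quotientStructure n (colored I col)))
      (Quotient.mk (ptpSetoid n (colored I col)) e) := by
    refine ⟨by change k < m; omega, fun j => v (ε.symm (some j)), ?_⟩
    intro a ha
    obtain ⟨b, hb, rfl⟩ := List.mem_map.1 ha
    rw [Atom.map_map]
    convert hv b hb using 1
    refine Atom.map_congr fun i => ?_
    simp only [Function.comp]
    cases h : ε (b.args i) with
    | none =>
      have : b.args i = r.head.args i₀ := ε.injective (by rw [h, hε])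
      rw [this]
      exact he
    | some j =>
      simp only [Option.elim]
      rw [← h, Equiv.symm_apply_apply]
  rw [← hc e] at hΨ
  obtain ⟨-, w, hw⟩ := hΨ
  have hhead := hI (fun x => (ε x).elim e w) fun a ha =>
    hw _ (List.mem_map_of_mem (f := Atom.map ε) ha)
  refine ⟨⟨Sum.inl r.head.rel, fun i => (ε (r.head.args i)).elim e w⟩, Or.inl ⟨_, hhead, rfl⟩, ?_⟩
  refine congrArg (Atom.mk (S := S.withColors K) (Sum.inl r.head.rel)) (funext fun i => ?_)
  change Quotient.mk (ptpSetoid n (colored I col)) ((ε (r.head.args i)).elim e w)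
    = v (r.head.args i)
  rw [hargs i i₀, hε]
  exact he

/-! The tree of bags of a guarded program. -/

/-- The positions of a bag other than its own element: one for each element of the instance and
one for each variable of the body of a TGD. -/
abbrev Theory.Param {S : Signature} (T : Theory S) (A : Type) : Type :=
  A ⊕ Σ t : T.tgds, Fin t.1.body.n

/-- The positions of a bag; `none` is the element the bag was created with. -/
abbrev Theory.Slot {S : Signature} (T : Theory S) (A : Type) : Type :=
  Option (T.Param A)

/-- A way of creating a child of a bag: the TGD, and the position in the parent bag of each
parameter of the child. -/
abbrev Theory.Kind {S : Signature} (T : Theory S) (A : Type) : Type :=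
  T.tgds × (T.Param A → T.Slot A)

/-- The type of a bag: which positions hold the same element, and which atoms are true. -/
abbrev Theory.Label {S : Signature} (T : Theory S) (A : Type) : Type :=
  (T.Slot A → T.Slot A → Prop) × Set (Atom S (T.Slot A))

/-- The elements of the tree: those of the instance, and one for each bag. A bag is given by the
path that leads to it, its last step coming first. -/
abbrev Theory.Elem {S : Signature} (T : Theory S) (A : Type) : Type :=
  A ⊕ List (T.Kind A)

namespace Theory

variable {S : Signature} {T : Theory S} {A : Type}

/-- The parameter that stands for a variable of the body of a TGD. -/
def bodyParam (t : T.tgds) (i : Fin t.1.body.n) : T.Param A :=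
  Sum.inr ⟨t, i⟩

/-- The tuple `h` realizes the label `p` in `I`. -/
def Fits (p : T.Label A) {M : Type} (I : Set (Atom S M)) (h : T.Slot A → M) : Prop :=
  (∀ l l', p.1 l l' → h l = h l') ∧ ∀ a ∈ p.2, a.map h ∈ I

/-- The label with all the atoms that follow from the given ones. -/
def closeLabel (p : T.Label A) : T.Label A :=
  (p.1, {a | ∀ (M : Type) (I : Set (Atom S M)), T.TrueIn I → ∀ h, Fits p I h → a.map h ∈ I})

/-- All the atoms that follow from the label belong to it. -/
def IsClosedLabel (p : T.Label A) : Prop :=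
  ∀ a, (∀ (M : Type) (I : Set (Atom S M)), T.TrueIn I → ∀ h, Fits p I h → a.map h ∈ I) → a ∈ p.2

theorem Fits.closeLabel {p : T.Label A} {M : Type} {I : Set (Atom S M)} {h : T.Slot A → M}
    (hp : Fits p I h) (hI : T.TrueIn I) : Fits (closeLabel p) I h :=
  ⟨hp.1, fun _ ha => ha M I hI h hp⟩

theorem isClosedLabel_closeLabel (p : T.Label A) : IsClosedLabel (closeLabel p) :=
  fun _ ha M I hI h hp => ha M I hI h (hp.closeLabel hI)

theorem mem_closeLabel {p : T.Label A} {a : Atom S (T.Slot A)} (ha : a ∈ p.2) :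
    a ∈ (closeLabel p).2 :=
  fun _ _ _ _ hp => hp.2 a ha

/-- The equality type of the bag of a child. -/
def stepRel (κ : T.Kind A) (r : T.Slot A → T.Slot A → Prop) : T.Slot A → T.Slot A → Prop
  | none, none => True
  | some x, some y => r (κ.2 x) (κ.2 y)
  -- The new element is distinct from the inherited ones in the tree only: `Fits` allows a
  -- realization to identify more.
  | _, _ => False

/-- The label of a child of a bag. -/
def stepLabel (κ : T.Kind A) (p : T.Label A) : T.Label A :=
  closeLabel (stepRel κ p.1,
    {κ.1.1.head.map (Option.map (bodyParam κ.1))} ∪ {a | ∃ b : Atom S (T.Param A), b.map κ.2 ∈ p.2 ∧ a = b.map some})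

/-- The body of the TGD is true in the bag. -/
def Applicable (κ : T.Kind A) (p : T.Label A) : Prop :=
  ∀ a ∈ κ.1.1.body.atoms, a.map (fun i => κ.2 (bodyParam κ.1 i)) ∈ p.2

/-- The elements of a bag. -/
def bag : List (T.Kind A) → T.Slot A → T.Elem A
  | [], some (Sum.inl a) => Sum.inl a
  -- The positions of body variables have no use at the root and are filled with the root element.
  | [], _ => Sum.inr []
  | κ :: u, none => Sum.inr (κ :: u)
  | κ :: u, some x => bag u (κ.2 x)

@[simp] theorem bag_none (e : List (T.Kind A)) : bag e none = Sum.inr e := by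
  cases e <;> rfl

@[simp] theorem bag_cons_some (κ : T.Kind A) (u : List (T.Kind A)) (x : T.Param A) :
    bag (κ :: u) (some x) = bag u (κ.2 x) := rfl

/-- The label of the bag that contains the elements of the instance. -/
def rootLabel (D : Set (Atom S A)) : T.Label A :=
  closeLabel (fun l l' => bag [] l = bag [] l', Atom.map (fun a => some (Sum.inl a)) '' D)

/-- The label of a bag. -/
def label (D : Set (Atom S A)) : List (T.Kind A) → T.Label A
  | [] => rootLabel D
  | κ :: u => stepLabel κ (label D u)

/-- Each step of the path to the bag applies a TGD whose body is true. -/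
def IsBag (D : Set (Atom S A)) : List (T.Kind A) → Prop
  | [] => True
  | κ :: u => Applicable κ (label D u) ∧ IsBag D u

def depth : T.Elem A → ℕ
  | Sum.inl _ => 0
  | Sum.inr e => e.length + 1

theorem depth_bag_le (e : List (T.Kind A)) (l : T.Slot A) : depth (bag e l) ≤ e.length + 1 := by
  induction e generalizing l with
  | nil => rcases l with _ | _ | _ <;> simp [bag, depth]
  | cons κ u ih =>
    cases l with
    | none => simp [depth]
    | some x => exact (ih _).trans (by simp)

/-- The equality type computed along the path is the true one because a new element is deeper than
everything in the parent's bag. -/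
theorem label_rel (D : Set (Atom S A)) (e : List (T.Kind A)) (l l' : T.Slot A) :
    (label D e).1 l l' ↔ bag e l = bag e l' := by
  induction e generalizing l l' with
  | nil => rfl
  | cons κ u ih =>
    have hne : ∀ x, bag u x ≠ Sum.inr (κ :: u) := fun x h => by
      have := depth_bag_le u x
      rw [h] at this
      simp [depth] at this
    cases l <;> cases l'
    · simp [label, stepLabel, closeLabel, stepRel]
    · simpa [label, stepLabel, closeLabel, stepRel] using (hne _).symm
    · simpa [label, stepLabel, closeLabel, stepRel] using hne _
    · exact ih _ _

theorem isClosedLabel_label (D : Set (Atom S A)) (e : List (T.Kind A)) :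
    IsClosedLabel (label D e) := by
  cases e <;> exact isClosedLabel_closeLabel _

/-- The witness that a model provides for the TGD extends a realization of the parent to one of the
child. This gives both the conservativity of children and the children in the tuple model. -/
theorem Fits.exists_step {κ : T.Kind A} {p : T.Label A} {M : Type} {I : Set (Atom S M)}
    {h : T.Slot A → M} (hp : Fits p I h) (hI : T.TrueIn I) (hκ : Applicable κ p) :
    ∃ y, Fits (stepLabel κ p) I (fun l => l.elim y fun x => h (κ.2 x)) := by
  obtain ⟨y, hy⟩ := hI.2 κ.1.1 κ.1.2 (fun i => h (κ.2 (bodyParam κ.1 i))) fun a ha =>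
    hp.2 _ (hκ a ha)
  refine ⟨y, Fits.closeLabel ⟨?_, ?_⟩ hI⟩
  · rintro (_ | x) (_ | x') hr
    · rfl
    · exact hr.elim
    · exact hr.elim
    · exact hp.1 _ _ hr
  · rintro a (rfl | ⟨b, hb, rfl⟩)
    · rw [TGD.headWith] at hy
      rw [Atom.map_map]
      convert hy using 1
      refine Atom.map_congr fun i => ?_
      simp only [Function.comp]
      cases κ.1.1.head.args i <;> rfl
    · exact hp.2 _ hb

/-- The position in the bag `z` of the element at a position of the bag `p ++ z`, if the element
belongs to the bag `z`. -/
def trace : List (T.Kind A) → T.Slot A → Option (T.Slot A)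
  | [], l => some l
  | _ :: _, none => none
  | κ :: p, some x => trace p (κ.2 x)

theorem bag_of_trace_eq_some {p : List (T.Kind A)} {l l' : T.Slot A} (h : trace p l = some l')
    (z : List (T.Kind A)) : bag (p ++ z) l = bag z l' := by
  induction p generalizing l with
  | nil =>
    obtain rfl : l = l' := Option.some_injective _ h
    rfl
  | cons κ p ih =>
    cases l with
    | none => exact absurd h (by simp [trace])
    | some x => exact ih h

theorem exists_of_trace_eq_none {p : List (T.Kind A)} {l : T.Slot A} (h : trace p l = none)
    (z : List (T.Kind A)) : z.length + 1 < depth (bag (p ++ z) l) := by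
  induction p generalizing l with
  | nil => exact absurd h (by simp [trace])
  | cons κ p ih =>
    cases l with
    | none =>
      simp [depth]
    | some x => exact ih h

/-- Elements of the bag `p ++ z` missing from the bag `z` were created after `z`, so depth alone
decides membership. -/
theorem exists_trace_eq_some {p z : List (T.Kind A)} {l : T.Slot A}
    (h : depth (bag (p ++ z) l) ≤ z.length + 1) : ∃ l', trace p l = some l' := by
  cases ht : trace p l with
  | none => exact absurd (exists_of_trace_eq_none ht z) (by omega)
  | some l' => exact ⟨l', rfl⟩

theorem suffix_of_bag_eq {e z : List (T.Kind A)} {l : T.Slot A} (h : bag e l = Sum.inr z) :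
    z <:+ e := by
  induction e generalizing l with
  | nil =>
    have : z = [] := by
      rcases l with _ | _ | _ <;> simp [bag] at h <;> exact h
    exact this ▸ List.suffix_refl _
  | cons κ u ih =>
    cases l with
    | none =>
      rw [bag_none] at h
      exact Sum.inr_injective h ▸ List.suffix_refl _
    | some x => exact (ih h).trans (List.suffix_cons κ u)

theorem IsBag.of_append {D : Set (Atom S A)} {p z : List (T.Kind A)} (h : IsBag D (p ++ z)) :
    IsBag D z := by
  induction p with
  | nil => exact h
  | cons κ p ih => exact ih h.2

/-- Labels behave like states of an automaton: what happens below a bag depends only on its label,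
so subtrees can be transplanted (`IsBag.append`). -/
theorem label_append {D : Set (Atom S A)} {z z' : List (T.Kind A)} (h : label D z = label D z')
    (p : List (T.Kind A)) : label D (p ++ z) = label D (p ++ z') := by
  induction p with
  | nil => exact h
  | cons κ p ih => exact congrArg (stepLabel κ) ih

theorem IsBag.append {D : Set (Atom S A)} {p z z' : List (T.Kind A)} (hp : IsBag D (p ++ z))
    (hz' : IsBag D z') (h : label D z = label D z') : IsBag D (p ++ z') := by
  induction p with
  | nil => exact hz'
  | cons κ p ih => exact ⟨label_append h p ▸ hp.1, ih hp.2⟩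

/-- Within a bag, the truth of an atom depends on the elements only. -/
theorem mem_label_of_map_bag_eq {D : Set (Atom S A)} {e : List (T.Kind A)}
    {a b : Atom S (T.Slot A)} (ha : a ∈ (label D e).2) (h : a.map (bag e) = b.map (bag e)) :
    b ∈ (label D e).2 := by
  refine isClosedLabel_label D e b fun M I _ f hf => ?_
  obtain ⟨args, rfl, hargs⟩ := Atom.exists_args_of_map_eq h
  convert hf.2 _ ha using 1
  exact congrArg (Atom.mk b.rel) (funext fun i => (hf.1 _ _ ((label_rel D e _ _).2 (hargs i))).symm)

/-- An atom about inherited elements that the child entails holds for every realization of the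
parent, as each extends to the child; the parent's label is closed, so it already has the atom. -/
theorem mem_label_cons_iff {D : Set (Atom S A)} {κ : T.Kind A} {u : List (T.Kind A)}
    (hκ : Applicable κ (label D u)) (b : Atom S (T.Param A)) :
    b.map some ∈ (label D (κ :: u)).2 ↔ b.map κ.2 ∈ (label D u).2 := by
  refine ⟨fun h => isClosedLabel_label D u _ fun M I hI f hf => ?_,
    fun h => mem_closeLabel (Or.inr ⟨b, h, rfl⟩)⟩
  obtain ⟨y, hy⟩ := hf.exists_step hI hκ
  exact hy.2 _ h

theorem mem_label_append_iff {D : Set (Atom S A)} {p z : List (T.Kind A)} (hp : IsBag D (p ++ z))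
    {R : S.Rel} {x x' : Fin (S.arity R) → T.Slot A} (h : ∀ i, trace p (x i) = some (x' i)) :
    ⟨R, x⟩ ∈ (label D (p ++ z)).2 ↔ ⟨R, x'⟩ ∈ (label D z).2 := by
  induction p generalizing x with
  | nil =>
    obtain rfl : x = x' := funext fun i => Option.some_injective _ (h i)
    rfl
  | cons κ p ih =>
    have : ∀ i, ∃ y, some y = x i := by
      intro i
      have := h i
      cases hx : x i with
      | none => rw [hx] at this; simp [trace] at this
      | some y => exact ⟨y, rfl⟩
    choose y hy using this
    obtain rfl : (fun i => some (y i)) = x := funext hy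
    exact (mem_label_cons_iff hp.1 ⟨R, y⟩).trans (ih hp.2 h)

/-- An atom of a bag is an atom of the bag of the youngest of its elements. -/
theorem exists_youngest {D : Set (Atom S A)} {e : List (T.Kind A)} (he : IsBag D e) (R : S.Rel)
    (x : Fin (S.arity R) → T.Slot A) :
    ∃ z, IsBag D z ∧ z <:+ e ∧ ∃ y : Fin (S.arity R) → T.Slot A,
      (∀ i, bag z (y i) = bag e (x i)) ∧
      (⟨R, x⟩ ∈ (label D e).2 ↔ ⟨R, y⟩ ∈ (label D z).2) ∧
      ((∃ i, bag e (x i) = Sum.inr z) ∨ z = [] ∧ ∀ i, ∃ a, bag e (x i) = Sum.inl a) := by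
  have key : ∀ z, z <:+ e → (∀ i, depth (bag e (x i)) ≤ z.length + 1) →
      ∃ y : Fin (S.arity R) → T.Slot A, (∀ i, bag z (y i) = bag e (x i)) ∧
        (⟨R, x⟩ ∈ (label D e).2 ↔ ⟨R, y⟩ ∈ (label D z).2) := by
    rintro z ⟨p, rfl⟩ hz
    choose y hy using fun i => exists_trace_eq_some (hz i)
    exact ⟨y, fun i => (bag_of_trace_eq_some (hy i) z).symm, mem_label_append_iff he hy⟩
  by_cases hA : ∀ i, ∃ a, bag e (x i) = Sum.inl a
  · obtain ⟨y, hy⟩ := key [] (List.nil_suffix) fun i => by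
      obtain ⟨a, ha⟩ := hA i
      simp [ha, depth]
    exact ⟨[], trivial, List.nil_suffix, y, hy.1, hy.2, Or.inr ⟨rfl, hA⟩⟩
  · push Not at hA
    obtain ⟨i, hi⟩ := hA
    have : Nonempty (Fin (S.arity R)) := ⟨i⟩
    obtain ⟨j, hj⟩ := Finite.exists_max fun i => depth (bag e (x i))
    rcases hz : bag e (x j) with a | z
    · have := hj i
      rcases hi' : bag e (x i) with b | z
      · exact absurd hi' (hi b)
      · simp [hz, hi', depth] at this
    · have hze := suffix_of_bag_eq hz
      obtain ⟨y, hy⟩ := key z hze fun i => (hj i).trans (by rw [hz]; rfl)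
      obtain ⟨p, rfl⟩ := hze
      exact ⟨z, he.of_append, ⟨p, rfl⟩, y, hy.1, hy.2, Or.inl ⟨j, hz⟩⟩

/-- The truth of an atom in a bag depends on the elements only. -/
theorem mem_label_of_map_eq {D : Set (Atom S A)} {e e' : List (T.Kind A)} (he : IsBag D e)
    (he' : IsBag D e') {R : S.Rel} {x x' : Fin (S.arity R) → T.Slot A}
    (ha : ⟨R, x⟩ ∈ (label D e).2) (h : ∀ i, bag e (x i) = bag e' (x' i)) :
    ⟨R, x'⟩ ∈ (label D e').2 := by
  obtain ⟨z, -, -, y, hy, hmem, hz⟩ := exists_youngest he R x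
  obtain ⟨z', -, -, y', hy', hmem', hz'⟩ := exists_youngest he' R x'
  -- The youngest element is determined by the arguments: each candidate lies in the bag of the
  -- other, so each path is a suffix of the other.
  have hzz : z = z' := by
    rcases hz with ⟨i, hi⟩ | ⟨rfl, hz⟩ <;> rcases hz' with ⟨j, hj⟩ | ⟨rfl, hz'⟩
    · have h₁ : z <:+ z' := suffix_of_bag_eq ((hy' i).trans ((h i).symm.trans hi))
      have h₂ : z' <:+ z := suffix_of_bag_eq ((hy j).trans ((h j).trans hj))
      exact h₁.eq_of_length_le h₂.length_le
    · obtain ⟨a, ha⟩ := hz' i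
      rw [← h i, hi] at ha
      exact absurd ha (by simp)
    · obtain ⟨a, ha⟩ := hz j
      rw [h j, hj] at ha
      exact absurd ha (by simp)
    · rfl
  subst hzz
  rw [hmem']
  rw [hmem] at ha
  refine mem_label_of_map_bag_eq ha ?_
  exact congrArg (Atom.mk R) (funext fun i => (hy i).trans ((h i).trans (hy' i).symm))

end Theory

/-! ### Proper colorings and the finite quotient of the tree. -/

theorem exists_greedy_coloring {E W : Type} [Finite W] (depth : E → ℕ) (f : W → E → E)
    (hf : ∀ w x, f w x ≠ x → depth (f w x) < depth x) :
    ∃ c : E → Option W, ∀ x w, f w x ≠ x → c (f w x) ≠ c x := by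
  -- At most `|W|` colors are forbidden at each element, and `Option W` has one more.
  have hex : ∀ g : W → Option W, ∃ k, ∀ w, g w ≠ k := by
    intro g
    by_contra h
    push Not at h
    have h₁ := Nat.card_le_card_of_surjective g h
    rw [Finite.card_option] at h₁
    omega
  classical
  let c : E → Option W := (measure depth).wf.fix fun x rec =>
    (hex fun w => if h : depth (f w x) < depth x then rec (f w x) h else none).choose
  have hc : ∀ x, c x =
      (hex fun w => if depth (f w x) < depth x then c (f w x) else none).choose := by
    intro x
    exact (measure depth).wf.fix_eq _ x
  refine ⟨c, fun x w hw => ?_⟩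
  have := (hex fun w => if depth (f w x) < depth x then c (f w x) else none).choose_spec w
  rw [← hc, if_pos (hf w x hw)] at this
  exact this

namespace Theory

variable {S : Signature} {T : Theory S} {A : Type}

/-- The elements of the bag of an element. -/
def slots : T.Elem A → T.Slot A → T.Elem A
  | Sum.inl a, _ => Sum.inl a
  | Sum.inr e, l => bag e l

/-- The label of the bag of an element; the elements of the instance are labelled by themselves. -/
def elemLabel (D : Set (Atom S A)) : T.Elem A → A ⊕ T.Label A
  | Sum.inl a => Sum.inl a
  | Sum.inr e => Sum.inr (label D e)

def IsElem (D : Set (Atom S A)) : T.Elem A → Prop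
  | Sum.inl _ => True
  | Sum.inr e => IsBag D e

theorem IsBag.isElem_bag {D : Set (Atom S A)} {e : List (T.Kind A)} (he : IsBag D e)
    (l : T.Slot A) : IsElem D (bag e l) := by
  cases h : bag e l with
  | inl a => trivial
  | inr z =>
    obtain ⟨p, rfl⟩ := suffix_of_bag_eq h
    exact he.of_append

theorem depth_slots_lt {x : T.Elem A} {l : T.Slot A} (h : slots x l ≠ x) :
    depth (slots x l) < depth x := by
  cases x with
  | inl a => exact absurd rfl h
  | inr e =>
    cases hz : slots (Sum.inr e) l with
    | inl a => simp [depth]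
    | inr z =>
      have hs : z <:+ e := suffix_of_bag_eq hz
      have := hs.length_le
      rcases this.lt_or_eq with hlt | heq
      · simpa [depth] using hlt
      · exact absurd (hs.eq_of_length heq ▸ hz) h

theorem depth_foldl_slots_le (w : List (T.Slot A)) (x : T.Elem A) :
    depth (w.foldl slots x) ≤ depth x ∧ (w.foldl slots x ≠ x → depth (w.foldl slots x) < depth x) := by
  induction w generalizing x with
  | nil => exact ⟨le_rfl, fun h => absurd rfl h⟩
  | cons l w ih =>
    by_cases h : slots x l = x
    · simpa [List.foldl_cons, h] using ih x
    · have := (ih (slots x l)).1.trans_lt (depth_slots_lt h)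
      exact ⟨this.le, fun _ => this⟩

/-- The label knows which positions hold the bag's own element. -/
theorem slots_eq_self_iff {D : Set (Atom S A)} {x y : T.Elem A}
    (h : elemLabel D x = elemLabel D y) (l : T.Slot A) : slots x l = x ↔ slots y l = y := by
  rcases x with a | e <;> rcases y with b | e'
  · exact iff_of_true rfl rfl
  · simp [elemLabel] at h
  · simp [elemLabel] at h
  · have h' : label D e = label D e' := Sum.inr_injective h
    have h₁ := label_rel D e l none
    have h₂ := label_rel D e' l none
    rw [bag_none] at h₁ h₂
    rw [h'] at h₁
    exact h₁.symm.trans h₂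

theorem eq_inl_of_elemLabel_eq {D : Set (Atom S A)} {x : T.Elem A} {a : A}
    (h : elemLabel D x = Sum.inl a) : x = Sum.inl a := by
  rcases x with b | e
  · exact congrArg Sum.inl (Sum.inl_injective h)
  · simp [elemLabel] at h

theorem exists_eq_inr_of_elemLabel_eq {D : Set (Atom S A)} {x : T.Elem A} {p : T.Label A}
    (h : elemLabel D x = Sum.inr p) : ∃ e, x = Sum.inr e ∧ label D e = p := by
  rcases x with b | e
  · simp [elemLabel] at h
  · exact ⟨e, rfl, Sum.inr_injective h⟩

/-- Two elements of a bag belong to the bag of one of them. -/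
theorem exists_slots_eq {e z : List (T.Kind A)} {l l' : T.Slot A} (hz : bag e l' = Sum.inr z)
    (h : depth (bag e l) ≤ depth (bag e l')) : ∃ k, slots (bag e l') k = bag e l := by
  obtain ⟨p, rfl⟩ := suffix_of_bag_eq hz
  rw [hz] at h ⊢
  obtain ⟨k, hk⟩ := exists_trace_eq_some h
  exact ⟨k, (bag_of_trace_eq_some hk z).symm⟩

/-- The coloring distinguishes each element from those reached from it in at most `N` steps, each
of which goes to an element of the current bag. -/
def IsProper (N : ℕ) {C : Type} (c : T.Elem A → C) : Prop :=
  ∀ (w : List (T.Slot A)) (x : T.Elem A), w.length ≤ N → w.foldl slots x ≠ x →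
    c (w.foldl slots x) ≠ c x

/-- There are finitely many walks of length at most `N`, and a walk that does not end where it began
lowers the depth, so the greedy coloring applies. -/
theorem exists_isProper [Finite A] (N : ℕ) :
    ∃ (C : Type) (_ : Finite C) (c : T.Elem A → C), IsProper N c := by
  have : Finite {w : List (T.Slot A) // w.length ≤ N} := List.finite_length_le _ N
  obtain ⟨c, hc⟩ := exists_greedy_coloring (W := {w : List (T.Slot A) // w.length ≤ N})
    depth (fun w x => w.1.foldl slots x) fun w x => (depth_foldl_slots_le w.1 x).2
  exact ⟨_, inferInstance, c, fun w x hw => hc x ⟨w, hw⟩⟩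

/-- The colors of the elements, with the colors of the elements reached in `k` steps. -/
def DeepColor (T : Theory S) (A C : Type) : ℕ → Type
  | 0 => C × (A ⊕ T.Label A)
  | k + 1 => (C × (A ⊕ T.Label A)) × (T.Slot A → DeepColor T A C k)

instance DeepColor.instFinite [Finite S.Rel] [Finite A] {C : Type} [Finite C] (k : ℕ) :
    Finite (DeepColor T A C k) := by
  induction k with
  | zero => exact inferInstanceAs (Finite (C × (A ⊕ T.Label A)))
  | succ k ih =>
    exact inferInstanceAs (Finite ((C × (A ⊕ T.Label A)) × (T.Slot A → DeepColor T A C k)))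

section

variable {C : Type} (c : T.Elem A → C) (D : Set (Atom S A))

def deepColor : (k : ℕ) → T.Elem A → DeepColor T A C k
  | 0, x => (c x, elemLabel D x)
  | k + 1, x => ((c x, elemLabel D x), fun l => deepColor k (slots x l))

variable {c D}

theorem elemLabel_eq_of_deepColor_eq {k : ℕ} {x y : T.Elem A}
    (h : deepColor c D k x = deepColor c D k y) : elemLabel D x = elemLabel D y := by
  cases k with
  | zero => exact congrArg Prod.snd h
  | succ k => exact congrArg (fun q => q.1.2) h

theorem color_eq_of_deepColor_eq {k : ℕ} {x y : T.Elem A}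
    (h : deepColor c D k x = deepColor c D k y) : c x = c y := by
  cases k with
  | zero => exact congrArg Prod.fst h
  | succ k => exact congrArg (fun q => q.1.1) h

theorem deepColor_slots_eq {k : ℕ} {x y : T.Elem A}
    (h : deepColor c D (k + 1) x = deepColor c D (k + 1) y) (l : T.Slot A) :
    deepColor c D k (slots x l) = deepColor c D k (slots y l) :=
  congrFun (congrArg Prod.snd h) l

theorem deepColor_eq_of_succ {k : ℕ} {x y : T.Elem A}
    (h : deepColor c D (k + 1) x = deepColor c D (k + 1) y) :
    deepColor c D k x = deepColor c D k y := by
  induction k generalizing x y with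
  | zero => exact congrArg Prod.fst h
  | succ k ih =>
    exact Prod.ext (congrArg (fun q : DeepColor T A C (k + 1 + 1) => q.1) h) (funext fun l => ih (deepColor_slots_eq h l))

theorem deepColor_eq_of_le {j k : ℕ} (hjk : j ≤ k) {x y : T.Elem A}
    (h : deepColor c D k x = deepColor c D k y) : deepColor c D j x = deepColor c D j y := by
  induction hjk with
  | refl => exact h
  | step _ ih => exact ih (deepColor_eq_of_succ h)

/-- A set of at most `k` elements has a member that does not look, up to depth `k`, like an
element of the bag of another member. -/
theorem exists_sink {N k : ℕ} (hc : IsProper N c) (hk : k ≤ N) {X : Finset (T.Elem A)}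
    (hX : X.Nonempty) (hXk : X.card ≤ k) :
    ∃ y ∈ X, ∀ x ∈ X, ∀ l, deepColor c D k (slots x l) = deepColor c D k y → slots x l = x := by
  by_contra hcon
  push Not at hcon
  -- Without a sink, each `y` looks like a member, other than the owner, of the bag of `next y`.
  choose next hnext l hl hne using fun y : X => hcon y.1 y.2
  obtain ⟨x₀, hx₀⟩ := hX
  let y : ℕ → X := fun i => (fun y : X => (⟨next y, hnext y⟩ : X))^[i] ⟨x₀, hx₀⟩
  have hy : ∀ i, (y (i + 1)).1 = next (y i) := fun i => by
    simp only [y, Function.iterate_succ_apply']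
  -- Following `r` of these arrows backwards by a real walk in the tree uses up `r` levels of deep
  -- color and lowers the depth by at least `r`.
  have walk : ∀ r, r ≤ k → ∀ i, ∃ w : List (T.Slot A), w.length = r ∧
      deepColor c D (k - r) (w.foldl slots (y (i + r)).1) = deepColor c D (k - r) (y i).1 ∧
      depth (w.foldl slots (y (i + r)).1) + r ≤ depth (y (i + r)).1 := by
    intro r
    induction r with
    | zero => exact fun _ i => ⟨[], rfl, rfl, le_rfl⟩
    | succ r ih =>
      intro hr i
      obtain ⟨w, hw, hcol, hd⟩ := ih (by omega) (i + 1)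
      have hi : i + (r + 1) = i + 1 + r := by omega
      rw [hi]
      have hkr : k - r = k - (r + 1) + 1 := by omega
      rw [hkr] at hcol
      refine ⟨w ++ [l (y i)], by simp [hw], ?_, ?_⟩
      · rw [List.foldl_append]
        refine (deepColor_slots_eq hcol _).trans ?_
        refine (deepColor_eq_of_le (Nat.sub_le k (r + 1)) ?_)
        rw [hy]
        exact hl (y i)
      · rw [List.foldl_append]
        have hne' : slots (w.foldl slots (y (i + 1 + r)).1) (l (y i)) ≠
            w.foldl slots (y (i + 1 + r)).1 := by
          intro h
          refine hne (y i) ?_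
          rw [← hy]
          exact (slots_eq_self_iff (elemLabel_eq_of_deepColor_eq hcol) _).1 h
        have := depth_slots_lt hne'
        simp only [List.foldl_cons, List.foldl_nil]
        omega
  -- Among `k + 1` terms of the sequence two coincide; the walk between them joins distinct elements
  -- of one color, against properness.
  obtain ⟨i, j, hij, hyij⟩ : ∃ i j : Fin (k + 1), i ≠ j ∧ y i = y j := by
    have : ¬ Function.Injective fun i : Fin (k + 1) => y i := fun h => by
      have := Fintype.card_le_of_injective _ h
      rw [Fintype.card_fin, Fintype.card_coe] at this
      omega
    simp only [Function.Injective] at this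
    push Not at this
    obtain ⟨i, j, h, hij⟩ := this
    exact ⟨i, j, hij, h⟩
  have key : ∀ i j : ℕ, i < j → j ≤ k → y i = y j → False := by
    intro i j hij hj h
    obtain ⟨w, hw, hcol, hd⟩ := walk (j - i) (by omega) i
    rw [show i + (j - i) = j by omega] at hcol hd
    rw [h] at hcol
    refine hc w (y j).1 (by omega) (fun h => ?_) (color_eq_of_deepColor_eq hcol)
    rw [h] at hd
    omega
  rcases lt_or_gt_of_ne (Fin.val_ne_of_ne hij) with h | h
  · exact key _ _ h (by omega) hyij
  · exact key _ _ h (by omega) hyij.symm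

/-- Of the members of the bag of `y` that resemble elements of `X`, take the deepest, `z`. All the
others lie in the bag of `z`, so moving the path from `z` to `y` onto the lift of `z` puts all of
them right at once. -/
theorem exists_lift_sink {k : ℕ} {X : Finset (T.Elem A)} {y : T.Elem A} (hy : IsElem D y)
    {h : T.Elem A → T.Elem A} (hX : ∀ x ∈ X, IsElem D (h x) ∧ elemLabel D (h x) = elemLabel D x)
    (hh : ∀ x ∈ X, ∀ z ∈ X, ∀ l, deepColor c D k (slots z l) = deepColor c D k x →
      slots (h z) l = h x) :
    ∃ y', IsElem D y' ∧ elemLabel D y' = elemLabel D y ∧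
      ∀ x ∈ X, ∀ l, deepColor c D (k + 1) (slots y l) = deepColor c D (k + 1) x →
        slots y' l = h x := by
  by_cases hA : ∀ x ∈ X, ∀ l, deepColor c D (k + 1) (slots y l) = deepColor c D (k + 1) x →
      ∃ a, slots y l = Sum.inl a
  · refine ⟨y, hy, rfl, fun x hx l hl => ?_⟩
    obtain ⟨a, ha⟩ := hA x hx l hl
    rw [ha] at hl ⊢
    refine (eq_inl_of_elemLabel_eq (D := D) ?_).symm
    exact (hX x hx).2.trans (elemLabel_eq_of_deepColor_eq hl).symm
  · push Not at hA
    obtain ⟨x₁, hx₁, l₁, hl₁, hne⟩ := hA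
    -- The depths of the relevant members; its maximum selects `z`.
    let Z : Set ℕ := {d | ∃ x ∈ X, ∃ l, deepColor c D (k + 1) (slots y l) =
      deepColor c D (k + 1) x ∧ depth (slots y l) = d}
    have hZ : BddAbove Z := by
      refine ⟨depth y, ?_⟩
      rintro d ⟨x, -, l, -, rfl⟩
      exact (depth_foldl_slots_le [l] y).1
    obtain ⟨x₀, hx₀, l₀, hl₀, hd₀⟩ := Nat.sSup_mem (s := Z) ⟨_, x₁, hx₁, l₁, hl₁, rfl⟩ hZ
    have hmax : ∀ x ∈ X, ∀ l, deepColor c D (k + 1) (slots y l) = deepColor c D (k + 1) x →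
        depth (slots y l) ≤ depth (slots y l₀) := fun x hx l hl =>
      hd₀ ▸ le_csSup hZ ⟨x, hx, l, hl, rfl⟩
    cases hz : slots y l₀ with
    | inl a =>
      have := hmax x₁ hx₁ l₁ hl₁
      rw [hz] at this
      cases hz' : slots y l₁ with
      | inl b => exact absurd hz' (hne b)
      | inr z => rw [hz'] at this; simp [depth] at this
    | inr z =>
      rcases y with a | e
      · simp [slots] at hz
      obtain ⟨p, rfl⟩ := suffix_of_bag_eq hz
      rw [hz] at hl₀ hmax
      obtain ⟨z', hz', hlab⟩ := exists_eq_inr_of_elemLabel_eq (D := D)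
        ((hX x₀ hx₀).2.trans (elemLabel_eq_of_deepColor_eq hl₀).symm)
      have hbag' : IsBag D z' := by
        have := (hX x₀ hx₀).1
        rwa [hz'] at this
      refine ⟨Sum.inr (p ++ z'), IsBag.append hy hbag' hlab.symm,
        congrArg Sum.inr (label_append hlab p), fun x hx l hl => ?_⟩
      obtain ⟨l', hl'⟩ := exists_trace_eq_some (hmax x hx l hl)
      have h₁ : slots (Sum.inr (p ++ z')) l = slots (h x₀) l' := by
        rw [hz']
        exact bag_of_trace_eq_some hl' z'
      rw [h₁]
      refine hh x hx x₀ hx₀ l' ?_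
      refine (deepColor_slots_eq hl₀ l').symm.trans (Eq.trans ?_ (deepColor_eq_of_succ hl))
      exact congrArg _ (bag_of_trace_eq_some hl' z).symm

/-- The elements of a set of at most `k` elements can be chosen anew, with the same labels, in
such a way that what looked like a bag up to depth `k` is a bag. -/
theorem exists_lift {N : ℕ} (hc : IsProper N c) (k : ℕ) (hk : k ≤ N) (X : Finset (T.Elem A))
    (hXk : X.card ≤ k) (hX : ∀ x ∈ X, IsElem D x) :
    ∃ h : T.Elem A → T.Elem A, (∀ x ∈ X, IsElem D (h x) ∧ elemLabel D (h x) = elemLabel D x) ∧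
      ∀ x ∈ X, ∀ y ∈ X, ∀ l, deepColor c D k (slots y l) = deepColor c D k x →
        slots (h y) l = h x := by
  classical
  induction k generalizing X with
  | zero =>
    obtain rfl : X = ∅ := Finset.card_eq_zero.1 (Nat.le_zero.1 hXk)
    exact ⟨id, by simp⟩
  | succ k ih =>
    -- Two members that look alike share one lift, which leaves a smaller set.
    by_cases hinj : ∃ x ∈ X, ∃ x' ∈ X, x ≠ x' ∧ deepColor c D (k + 1) x = deepColor c D (k + 1) x'
    · obtain ⟨x, hx, x', hx', hne, hcol⟩ := hinj
      obtain ⟨h, hh, hh'⟩ := ih (by omega) (X.erase x')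
        (by rw [Finset.card_erase_of_mem hx']; omega) fun z hz => hX z (Finset.mem_of_mem_erase hz)
      let r : T.Elem A → T.Elem A := fun z => if z = x' then x else z
      have hr : ∀ z ∈ X, r z ∈ X.erase x' := by
        intro z hz
        by_cases hzx : z = x'
        · simp [r, hzx, hne, hx]
        · simp [r, hzx, hz]
      have hrc : ∀ z, deepColor c D (k + 1) (r z) = deepColor c D (k + 1) z := by
        intro z
        by_cases hzx : z = x'
        · simp [r, hzx, hcol]
        · simp [r, hzx]
      refine ⟨h ∘ r, fun z hz => ⟨(hh _ (hr z hz)).1, (hh _ (hr z hz)).2.trans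
        (elemLabel_eq_of_deepColor_eq (hrc z))⟩, fun z hz y hy l hl => ?_⟩
      exact hh' _ (hr z hz) _ (hr y hy) l ((deepColor_slots_eq (hrc y) l).trans
        ((deepColor_eq_of_succ hl).trans (deepColor_eq_of_succ (hrc z)).symm))
    · rcases X.eq_empty_or_nonempty with rfl | hne
      · exact ⟨id, by simp⟩
      push Not at hinj
      -- The sink appears in no other member's bag, so it can be placed after all the others have
      -- been lifted.
      obtain ⟨y, hy, hsink⟩ := exists_sink (D := D) hc hk hne hXk
      obtain ⟨h, hh, hh'⟩ := ih (by omega) (X.erase y)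
        (by rw [Finset.card_erase_of_mem hy]; omega) fun z hz => hX z (Finset.mem_of_mem_erase hz)
      obtain ⟨y', hy', hlab, hslots⟩ := exists_lift_sink (hX y hy) hh hh'
      refine ⟨Function.update h y y', fun x hx => ?_, fun x hx z hz l hl => ?_⟩
      · by_cases hxy : x = y
        · subst hxy
          simpa using ⟨hy', hlab⟩
        · rw [Function.update_of_ne hxy]
          exact hh x (Finset.mem_erase.2 ⟨hxy, hx⟩)
      · by_cases hxy : x = y
        · subst hxy
          have hzl := hsink z hz l hl
          rw [hzl] at hl
          -- Here `z` itself looks like the sink, and distinct members look different.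
          obtain rfl : z = x := by
            by_contra hzx
            exact hinj z hz x hx hzx hl
          rw [Function.update_self]
          exact (slots_eq_self_iff hlab l).2 hzl
        · rw [Function.update_of_ne hxy]
          by_cases hzy : z = y
          · subst hzy
            rw [Function.update_self]
            exact hslots x (Finset.mem_erase.2 ⟨hxy, hx⟩) l hl
          · rw [Function.update_of_ne hzy]
            exact hh' x (Finset.mem_erase.2 ⟨hxy, hx⟩) z (Finset.mem_erase.2 ⟨hzy, hz⟩) l
              (deepColor_eq_of_succ hl)

/-- Deep colors distinguish the elements of a bag, and the elements of their bags. -/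
theorem slots_bag_eq_bag {N : ℕ} (hc : IsProper N c) (hN : 2 ≤ N) {e : List (T.Kind A)}
    {l₁ l₂ l₃ : T.Slot A} {k : ℕ}
    (h : deepColor c D k (slots (bag e l₁) l₃) = deepColor c D k (bag e l₂)) :
    slots (bag e l₁) l₃ = bag e l₂ := by
  cases hp : slots (bag e l₁) l₃ with
  | inl a =>
    rw [hp] at h
    exact (eq_inl_of_elemLabel_eq (D := D) (elemLabel_eq_of_deepColor_eq h).symm).symm
  | inr p =>
  cases hq : bag e l₂ with
  | inl a =>
    rw [hq] at h
    exact (hp.symm.trans (eq_inl_of_elemLabel_eq (D := D) (elemLabel_eq_of_deepColor_eq h)))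
  | inr q =>
  cases hz : bag e l₁ with
  | inl a => rw [hz] at hp; simp [slots] at hp
  | inr z =>
    rw [hp, hq] at h
    have hcol := color_eq_of_deepColor_eq h
    rw [hz] at hp
    by_contra hne
    -- If the two elements differed, one would reach the other in at most two steps, so properness
    -- with `2 ≤ N` would separate their colors.
    rcases le_total (depth (bag e l₂)) (depth (bag e l₁)) with hle | hle
    · obtain ⟨l₄, h₄⟩ := exists_slots_eq hz hle
      rw [hz, hq] at h₄
      change bag z l₃ = _ at hp
      change bag z l₄ = _ at h₄
      rcases le_total (depth (bag z l₃)) (depth (bag z l₄)) with hle | hle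
      · obtain ⟨l, hl⟩ := exists_slots_eq h₄ hle
        rw [hp, h₄] at hl
        refine hc [l] (Sum.inr q) (by simp; omega) ?_ ?_ <;> simp only [List.foldl_cons, List.foldl_nil, hl]
        · exact hne
        · exact hcol
      · obtain ⟨l, hl⟩ := exists_slots_eq hp hle
        rw [hp, h₄] at hl
        refine hc [l] (Sum.inr p) (by simp; omega) ?_ ?_ <;> simp only [List.foldl_cons, List.foldl_nil, hl]
        · exact fun h => hne h.symm
        · exact hcol.symm
    · obtain ⟨l, hl⟩ := exists_slots_eq hq hle
      rw [hz, hq] at hl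
      refine hc [l, l₃] (Sum.inr q) hN ?_ ?_ <;> simp only [List.foldl_cons, List.foldl_nil, hl, hp]
      · exact hne
      · exact hcol

/-- The truth of an atom in a bag depends on the deep colors of the elements only. -/
theorem mem_label_of_deepColor_eq {N k : ℕ} (hc : IsProper N c) (hN : 2 ≤ N)
    {e e' : List (T.Kind A)} (he : IsBag D e) (he' : IsBag D e') {R : S.Rel}
    {x x' : Fin (S.arity R) → T.Slot A} (ha : ⟨R, x⟩ ∈ (label D e).2)
    (h : ∀ i, deepColor c D (k + 1) (bag e (x i)) = deepColor c D (k + 1) (bag e' (x' i))) :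
    ⟨R, x'⟩ ∈ (label D e').2 := by
  obtain ⟨z, hz, -, y, hy, hmem, ⟨i, hi⟩ | ⟨-, hA⟩⟩ := exists_youngest he R x
  · rw [hmem] at ha
    have hi' := h i
    rw [hi] at hi'
    obtain ⟨z', hz', hlab⟩ := exists_eq_inr_of_elemLabel_eq (D := D)
      (elemLabel_eq_of_deepColor_eq hi').symm
    have hbag' : IsBag D z' := by
      have := he'.isElem_bag (x' i)
      rwa [hz'] at this
    -- The counterpart `z'` of the youngest element has the same label, so the atom holds at the
    -- same positions of its bag; only the elements there remain to be identified.
    rw [← hlab] at ha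
    refine mem_label_of_map_eq hbag' he' ha fun j => ?_
    have h₁ := (deepColor_slots_eq hi' (y j)).symm.trans (congrArg _ (hy j))
    have h₂ := slots_bag_eq_bag hc hN (h₁.trans (deepColor_eq_of_succ (h j)))
    rw [hz'] at h₂
    exact h₂
  · refine mem_label_of_map_eq he he' ha fun j => ?_
    obtain ⟨a, ha⟩ := hA j
    have := h j
    rw [ha] at this ⊢
    exact (eq_inl_of_elemLabel_eq (D := D) (elemLabel_eq_of_deepColor_eq this).symm).symm

variable (T D) in
/-- The structure formed by the bags. -/
def tree : Set (Atom S (T.Elem A)) :=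
  {f | ∃ e, IsBag D e ∧ ∃ a ∈ (label D e).2, f = a.map (bag e)}

variable (c D) in
/-- The quotient of the tree by the equality of deep colors. -/
def foldedTree (N : ℕ) : Set (Atom S (DeepColor T A C N)) :=
  Atom.map (deepColor c D N) '' T.tree D

theorem exists_of_mem_foldedTree {N : ℕ} {W : Type} {b : Atom S W} {v : W → DeepColor T A C N}
    (h : b.map v ∈ foldedTree c D N) : ∃ e, IsBag D e ∧ ∃ x : Fin (S.arity b.rel) → T.Slot A,
      ⟨b.rel, x⟩ ∈ (label D e).2 ∧ ∀ i, deepColor c D N (bag e (x i)) = v (b.args i) := by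
  obtain ⟨_, ⟨e, he, a, ha, rfl⟩, hb⟩ := h
  rw [Atom.map_map] at hb
  obtain ⟨x, rfl, hx⟩ := Atom.exists_args_of_map_eq hb
  exact ⟨e, he, x, ha, hx⟩

/-- This is where guardedness enters: the bag of a preimage of the guard represents all variables,
and the other atoms carry over to it because deep colors decide atoms. -/
theorem exists_body_mem_label {N k : ℕ} (hc : IsProper N c) (hN : 2 ≤ N) {Q : CQ S}
    (hQ : Q.IsGuarded) {v : Fin Q.n → DeepColor T A C (k + 1)}
    (hv : Q.SatBy (foldedTree c D (k + 1)) v) :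
    ∃ e, IsBag D e ∧ ∃ ρ : Fin Q.n → T.Slot A,
      (∀ i, deepColor c D (k + 1) (bag e (ρ i)) = v i) ∧
      ∀ a ∈ Q.atoms, a.map ρ ∈ (label D e).2 := by
  obtain ⟨g, hg, hguard⟩ := hQ
  obtain ⟨e, he, x, -, hxv⟩ := exists_of_mem_foldedTree (hv g hg)
  choose j hj using hguard
  have hρ : ∀ i, deepColor c D (k + 1) (bag e (x (j i))) = v i := fun i => by rw [hxv, hj]
  refine ⟨e, he, fun i => x (j i), hρ, fun a ha => ?_⟩
  obtain ⟨e', he', x', hx', hxv'⟩ := exists_of_mem_foldedTree (hv a ha)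
  exact mem_label_of_deepColor_eq hc hN he' he hx' fun i => (hxv' i).trans (hρ _).symm

/-- Datalog heads are already in the closed label of the bag of the body; a TGD is witnessed by a
child of that bag. -/
theorem foldedTree_trueIn {N k : ℕ} (hc : IsProper N c) (hN : 2 ≤ N) (hT : T.IsGuarded) :
    T.TrueIn (foldedTree c D (k + 1)) := by
  refine ⟨fun r hr v hv => ?_, fun t ht v hv => ?_⟩
  · obtain ⟨e, he, ρ, hρ, hbody⟩ := exists_body_mem_label hc hN (hT.1 r hr) hv
    refine ⟨r.head.map (fun i => bag e (ρ i)), ⟨e, he, r.head.map ρ, ?_, rfl⟩, ?_⟩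
    · exact isClosedLabel_label D e _ fun M I hI h hh =>
        hI.1 r hr (h ∘ ρ) fun a ha => hh.2 _ (hbody a ha)
    · exact (Atom.map_map _ _ _).trans (Atom.map_congr fun i => hρ _)
  · obtain ⟨e, he, ρ, hρ, hbody⟩ := exists_body_mem_label hc hN (hT.2 t ht) hv
    classical
    -- The child keeps the instance and the elements matched by the body of `t`. Parameters of other
    -- TGDs are irrelevant and receive the parent's own element.
    let κ : T.Kind A := (⟨t, ht⟩, fun x => match x with
      | Sum.inl a => some (Sum.inl a)
      | Sum.inr q => if h : q.1 = ⟨t, ht⟩ then ρ (Fin.cast (by rw [h]) q.2) else none)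
    have hκ : ∀ i, κ.2 (bodyParam κ.1 i) = ρ i := fun i => by simp [κ, bodyParam]
    have happ : Applicable κ (label D e) := fun a ha => by
      rw [funext hκ]
      exact hbody a ha
    refine ⟨deepColor c D (k + 1) (Sum.inr (κ :: e)), _, ⟨κ :: e, ⟨happ, he⟩, _,
      mem_closeLabel (Or.inl rfl), rfl⟩, ?_⟩
    rw [TGD.headWith, Atom.map_map, Atom.map_map]
    refine Atom.map_congr fun i => ?_
    simp only [Function.comp]
    cases t.head.args i with
    | none => rfl
    | some j => exact (congrArg (fun l => deepColor c D (k + 1) (bag e l)) (hκ j)).trans (hρ j)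

theorem foldedTree_contains (N : ℕ) : Contains (foldedTree c D N) D := by
  refine ⟨⟨fun a => deepColor c D N (Sum.inl a), fun a b h => ?_⟩, fun a ha => ?_⟩
  · exact Sum.inl_injective (elemLabel_eq_of_deepColor_eq h)
  · exact ⟨_, ⟨[], trivial, _, mem_closeLabel ⟨a, ha, rfl⟩, rfl⟩, rfl⟩

/-- A query that is true in the quotient is true in the tree, if deep colors are deep enough. -/
theorem holds_tree_of_holds_foldedTree {N k : ℕ} (hc : IsProper N c) (hk : k ≤ N) {Φ : CQ S}
    (hΦ : Φ.n ≤ k) (h : Φ.Holds (foldedTree c D (k + 1))) : Φ.Holds (T.tree D) := by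
  classical
  obtain ⟨v, hv⟩ := h
  have hex : ∀ q : Set.range v, ∃ x, IsElem D x ∧ deepColor c D (k + 1) x = q := by
    rintro ⟨_, x, rfl⟩
    obtain ⟨a, ha, i, rfl⟩ := Φ.occurs x
    obtain ⟨e, he, x, -, hx⟩ := exists_of_mem_foldedTree (hv a ha)
    exact ⟨bag e (x i), he.isElem_bag _, hx i⟩
  choose s hs hsc using hex
  let ξ : Fin Φ.n → T.Elem A := fun x => s ⟨v x, x, rfl⟩
  have hξ : ∀ x, deepColor c D (k + 1) (ξ x) = v x := fun x => hsc _
  have hmem : ∀ x, ξ x ∈ Finset.univ.image ξ := fun x =>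
    Finset.mem_image_of_mem ξ (Finset.mem_univ x)
  obtain ⟨h, hh, hh'⟩ := exists_lift (D := D) hc k hk (Finset.univ.image ξ)
    (Finset.card_image_le.trans (by simpa using hΦ)) (by
      intro x hx
      obtain ⟨i, -, rfl⟩ := Finset.mem_image.1 hx
      exact hs _)
  refine ⟨h ∘ ξ, fun a ha => ?_⟩
  obtain ⟨e, he, x, hx, hxv⟩ := exists_of_mem_foldedTree (hv a ha)
  obtain ⟨z, hz, -, y, hy, hmem', ⟨i, hi⟩ | ⟨-, hA⟩⟩ := exists_youngest he a.rel x
  · have hi' : deepColor c D (k + 1) (Sum.inr z) = deepColor c D (k + 1) (ξ (a.args i)) := by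
      rw [← hi, hxv, hξ]
    -- The lift of the youngest argument has the label of `z`, hence the same atom. The extra level
    -- of deep color compares its bag with the other arguments.
    obtain ⟨z', hz', hlab⟩ := exists_eq_inr_of_elemLabel_eq (D := D)
      ((hh _ (hmem (a.args i))).2.trans (elemLabel_eq_of_deepColor_eq hi').symm)
    have hbag' : IsBag D z' := by
      have := (hh _ (hmem (a.args i))).1
      rwa [hz'] at this
    refine ⟨z', hbag', ⟨a.rel, y⟩, hlab ▸ hmem'.1 hx, ?_⟩
    refine congrArg (Atom.mk a.rel) (funext fun j => ?_)
    have h₁ := hh' _ (hmem (a.args j)) _ (hmem (a.args i)) (y j) (by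
      refine (deepColor_slots_eq hi' (y j)).symm.trans ((congrArg _ (hy j)).trans ?_)
      exact deepColor_eq_of_succ ((hxv j).trans (hξ _).symm))
    rw [hz'] at h₁
    exact h₁.symm
  · refine ⟨e, he, _, hx, congrArg (Atom.mk a.rel) (funext fun j => ?_)⟩
    obtain ⟨b, hb⟩ := hA j
    have h₁ := (hxv j).trans (hξ (a.args j)).symm
    change h (ξ (a.args j)) = bag e (x j)
    rw [hb] at h₁ ⊢
    exact eq_inl_of_elemLabel_eq (D := D)
      ((hh _ (hmem (a.args j))).2.trans (elemLabel_eq_of_deepColor_eq h₁).symm)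

end

/-- A query that is true in all finite models is true in the tree. -/
theorem holds_tree_of_forall_finite [Finite S.Rel] [Finite A] (hT : T.IsGuarded)
    {D : Set (Atom S A)} {Φ : CQ S} (h : T.FinEntails D Φ) : Φ.Holds (T.tree D) := by
  -- Lifting needs walks of length `Φ.n`, and rule bodies need length 2 even if `Φ.n = 0`.
  obtain ⟨C, _, c, hc⟩ := exists_isProper (T := T) (A := A) (Φ.n + 2)
  exact holds_tree_of_holds_foldedTree hc (by omega) (le_refl Φ.n)
    (h _ (foldedTree c D (Φ.n + 1)) (foldedTree_contains _)
      (foldedTree_trueIn hc (by omega) hT))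

end Theory

/-! Unary and binary atoms. -/

def Atom.un {S : Signature} {V : Type} (R : S.Rel) (x : V) : Atom S V :=
  ⟨R, fun _ => x⟩

def Atom.bin {S : Signature} {V : Type} (R : S.Rel) (x y : V) : Atom S V :=
  ⟨R, fun i => if i.val = 0 then x else y⟩

@[simp] theorem Atom.map_un {S : Signature} {V W : Type} (f : V → W) (R : S.Rel) (x : V) :
    (Atom.un R x).map f = Atom.un R (f x) := rfl

@[simp] theorem Atom.map_bin {S : Signature} {V W : Type} (f : V → W) (R : S.Rel) (x y : V) :
    (Atom.bin R x y).map f = Atom.bin R (f x) (f y) :=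
  congrArg (Atom.mk R) (funext fun _ => apply_ite f _ _ _)

theorem Atom.un_inj {S : Signature} {V : Type} {R R' : S.Rel} {x x' : V} (hR : S.arity R = 1)
    (h : Atom.un R x = Atom.un R' x') : R = R' ∧ x = x' := by
  simp only [Atom.un, Atom.mk.injEq] at h
  obtain ⟨rfl, h⟩ := h
  exact ⟨rfl, congrFun (eq_of_heq h) ⟨0, by omega⟩⟩

theorem Atom.bin_inj {S : Signature} {V : Type} {R R' : S.Rel} {x x' y y' : V}
    (hR : S.arity R = 2) (h : Atom.bin R x y = Atom.bin R' x' y') :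
    R = R' ∧ x = x' ∧ y = y' := by
  simp only [Atom.bin, Atom.mk.injEq] at h
  obtain ⟨rfl, h⟩ := h
  have h₀ := congrFun (eq_of_heq h) ⟨0, by omega⟩
  have h₁ := congrFun (eq_of_heq h) ⟨1, by omega⟩
  exact ⟨rfl, by simpa using h₀, by simpa using h₁⟩

namespace Theory

variable {S : Signature} {T : Theory S} {A : Type}

/-! A binary program whose chase is the tree of bags. -/

/-- The relations of the binary program: the names of the elements of the instance (and of the
root, `none`), the labels, the relation between an element and the parameters of its bag, and the
relation between the bags and their children. -/
inductive TreeRel (T : Theory S) (A : Type) : Type where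
  | base (b : Option A) : TreeRel T A
  | label (p : T.Label A) : TreeRel T A
  | param (x : T.Param A) : TreeRel T A
  | child (p : T.Label A) (κ : T.Kind A) : TreeRel T A

def TreeRel.arity : TreeRel T A → ℕ
  | .base _ => 1
  | .label _ => 1
  | .param _ => 2
  | .child _ _ => 2

variable (T A) in
abbrev treeSig : Signature := ⟨TreeRel T A, TreeRel.arity⟩

theorem treeSig_isBinary : (T.treeSig A).IsBinary := by
  rintro (_ | _ | _ | _)
  exacts [Or.inl rfl, Or.inl rfl, Or.inr rfl, Or.inr rfl]

instance treeSig.instFinite [Finite S.Rel] [Finite A] : Finite (T.treeSig A).Rel := by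
  refine Finite.of_surjective
    (α := (Option A ⊕ T.Label A) ⊕ (T.Param A ⊕ T.Label A × T.Kind A))
    (Sum.elim (Sum.elim TreeRel.base TreeRel.label)
      (Sum.elim TreeRel.param fun q => TreeRel.child q.1 q.2)) ?_
  rintro (b | p | x | ⟨p, κ⟩)
  exacts [⟨Sum.inl (Sum.inl b), rfl⟩, ⟨Sum.inl (Sum.inr p), rfl⟩, ⟨Sum.inr (Sum.inl x), rfl⟩,
    ⟨Sum.inr (Sum.inr (p, κ)), rfl⟩]

abbrev baseAtom {V : Type} (b : Option A) (x : V) : Atom (T.treeSig A) V :=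
  Atom.un (S := T.treeSig A) (TreeRel.base b) x

abbrev labelAtom {V : Type} (p : T.Label A) (x : V) : Atom (T.treeSig A) V :=
  Atom.un (S := T.treeSig A) (TreeRel.label p) x

abbrev paramAtom {V : Type} (z : T.Param A) (x y : V) : Atom (T.treeSig A) V :=
  Atom.bin (S := T.treeSig A) (TreeRel.param z) x y

abbrev childAtom {V : Type} (p : T.Label A) (κ : T.Kind A) (x y : V) : Atom (T.treeSig A) V :=
  Atom.bin (S := T.treeSig A) (TreeRel.child p κ) x y

/-- The position holds the element of the bag itself. -/
def IsSelf (p : T.Label A) : T.Slot A → Prop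
  | none => True
  | some x => p.1 (some x) none

theorem isSelf_label_iff (D : Set (Atom S A)) (e : List (T.Kind A)) (l : T.Slot A) :
    IsSelf (label D e) l ↔ bag e l = Sum.inr e := by
  cases l with
  | none => simp [IsSelf]
  | some x => rw [← bag_none e]; exact label_rel D e (some x) none

/-- A linear order on the elements of the instance, with the root at the end. -/
noncomputable def rank [Finite A] : Option A → ℕ
  | none => Nat.card A
  | some a => (Finite.equivFin A a).val

theorem rank_some_lt [Finite A] (a : A) : rank (some a) < rank (none : Option A) :=
  (Finite.equivFin A a).2

theorem eq_of_rank_eq [Finite A] {a a' : A} (h : rank (some a) = rank (some a')) : a = a' :=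
  (Finite.equivFin A).injective (Fin.ext h)

def baseTGD (b : Option A) : TGD (T.treeSig A) where
  body := ⟨0, [], fun x => x.elim0⟩
  head := baseAtom b none
  exists_occurs := ⟨⟨0, Nat.one_pos⟩, rfl⟩

/-- The relation remembers `p` and `κ`, so the edge determines the label and the parameters of the
child. -/
def childTGD (p : T.Label A) (κ : T.Kind A) : TGD (T.treeSig A) where
  body := ⟨1, [labelAtom p 0], fun _ =>
    ⟨_, List.mem_singleton_self _, ⟨0, Nat.one_pos⟩, Subsingleton.elim (α := Fin 1) _ _⟩⟩
  head := childAtom p κ (some 0) none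
  exists_occurs := ⟨⟨1, Nat.one_lt_two⟩, rfl⟩

/-- These edges make the named elements a chain, as the clique condition requires; as the root comes
last, they also give the root its parameters. -/
def orderRule (a : A) (b : Option A) : DatalogRule (T.treeSig A) where
  body := ⟨2, [baseAtom (some a) 0, baseAtom b 1], fun x => by
    match x with
    | 0 => exact ⟨baseAtom (some a) 0, by simp, ⟨0, Nat.one_pos⟩, rfl⟩
    | 1 => exact ⟨baseAtom b 1, by simp, ⟨0, Nat.one_pos⟩, rfl⟩⟩
  head := paramAtom (Sum.inl a) 0 1

def rootRule (D : Set (Atom S A)) : DatalogRule (T.treeSig A) where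
  body := ⟨1, [baseAtom none 0], fun _ =>
    ⟨_, List.mem_singleton_self _, ⟨0, Nat.one_pos⟩, Subsingleton.elim (α := Fin 1) _ _⟩⟩
  head := labelAtom (rootLabel D) 0

def childQuery (p : T.Label A) (κ : T.Kind A) : CQ (T.treeSig A) :=
  ⟨2, [childAtom p κ 0 1], fun x => by
    match x with
    | 0 => exact ⟨_, List.mem_singleton_self _, ⟨0, Nat.two_pos⟩, rfl⟩
    | 1 => exact ⟨_, List.mem_singleton_self _, ⟨1, Nat.one_lt_two⟩, rfl⟩⟩

def labelRule (p : T.Label A) (κ : T.Kind A) : DatalogRule (T.treeSig A) where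
  body := childQuery p κ
  head := labelAtom (stepLabel κ p) (1 : Fin 2)

/-- If the parameter is the parent's own element, the edge starts at the parent; otherwise
`paramRule` copies an edge of the parent. Positions holding the bag's own element get no edge, which
would be a loop. -/
def selfRule (p : T.Label A) (κ : T.Kind A) (x : T.Param A) : DatalogRule (T.treeSig A) where
  body := childQuery p κ
  head := paramAtom x (0 : Fin 2) (1 : Fin 2)

def paramRule (p : T.Label A) (κ : T.Kind A) (x x' : T.Param A) :
    DatalogRule (T.treeSig A) where
  body := ⟨3, [childAtom p κ 0 1, paramAtom x' 2 0], fun x => by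
    match x with
    | 0 => exact ⟨childAtom p κ 0 1, by simp, ⟨0, Nat.two_pos⟩, rfl⟩
    | 1 => exact ⟨childAtom p κ 0 1, by simp, ⟨1, Nat.one_lt_two⟩, rfl⟩
    | 2 => exact ⟨paramAtom x' 2 0, by simp, ⟨0, Nat.two_pos⟩, rfl⟩⟩
  head := paramAtom x 2 1

section

variable {M : Type} {J : Set (Atom (T.treeSig A) M)}

theorem baseTGD_headWith (b : Option A) (v : Fin (baseTGD (T := T) b).body.n → M) (y : M) :
    (baseTGD b).headWith v y = baseAtom b y := rfl

theorem childTGD_satBy {p : T.Label A} {κ : T.Kind A} {v : Fin (childTGD p κ).body.n → M} :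
    (childTGD p κ).body.SatBy J v ↔ labelAtom p (v (0 : Fin 1)) ∈ J := by
  have key : ∀ w : Fin 1 → M,
      (∀ c ∈ [labelAtom p (0 : Fin 1)], c.map w ∈ J) ↔ labelAtom p (w 0) ∈ J := by simp
  exact key v

theorem childTGD_headWith (p : T.Label A) (κ : T.Kind A) (v : Fin (childTGD p κ).body.n → M)
    (y : M) : (childTGD p κ).headWith v y = childAtom p κ (v (0 : Fin 1)) y :=
  Atom.map_bin _ _ _ _

theorem orderRule_satBy {a : A} {b : Option A} {v : Fin (orderRule (T := T) a b).body.n → M} :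
    (orderRule a b).body.SatBy J v ↔
      baseAtom (some a) (v (0 : Fin 2)) ∈ J ∧ baseAtom b (v (1 : Fin 2)) ∈ J := by
  have key : ∀ w : Fin 2 → M, (∀ c ∈ [baseAtom (some a) (0 : Fin 2), baseAtom b 1], c.map w ∈ J) ↔
      baseAtom (some a) (w 0) ∈ J ∧ baseAtom b (w 1) ∈ J := by simp
  exact key v

theorem orderRule_head (a : A) (b : Option A) (v : Fin (orderRule (T := T) a b).body.n → M) :
    (orderRule a b).head.map v = paramAtom (Sum.inl a) (v (0 : Fin 2)) (v (1 : Fin 2)) :=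
  Atom.map_bin _ _ _ _

theorem rootRule_satBy {D : Set (Atom S A)} {v : Fin (rootRule (T := T) D).body.n → M} :
    (rootRule D).body.SatBy J v ↔ baseAtom none (v (0 : Fin 1)) ∈ J := by
  have key : ∀ w : Fin 1 → M,
      (∀ c ∈ [baseAtom none (0 : Fin 1)], c.map w ∈ J) ↔ baseAtom none (w 0) ∈ J := by simp
  exact key v

theorem rootRule_head (D : Set (Atom S A)) (v : Fin (rootRule (T := T) D).body.n → M) :
    (rootRule D).head.map v = labelAtom (rootLabel D) (v (0 : Fin 1)) := rfl

theorem childQuery_satBy {p : T.Label A} {κ : T.Kind A} {v : Fin (childQuery p κ).n → M} :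
    (childQuery p κ).SatBy J v ↔ childAtom p κ (v (0 : Fin 2)) (v (1 : Fin 2)) ∈ J := by
  have key : ∀ w : Fin 2 → M,
      (∀ c ∈ [childAtom p κ (0 : Fin 2) 1], c.map w ∈ J) ↔ childAtom p κ (w 0) (w 1) ∈ J := by simp
  exact key v

theorem labelRule_head (p : T.Label A) (κ : T.Kind A) (v : Fin (labelRule p κ).body.n → M) :
    (labelRule p κ).head.map v = labelAtom (stepLabel κ p) (v (1 : Fin 2)) := rfl

theorem selfRule_head (p : T.Label A) (κ : T.Kind A) (x : T.Param A)
    (v : Fin (selfRule p κ x).body.n → M) :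
    (selfRule p κ x).head.map v = paramAtom x (v (0 : Fin 2)) (v (1 : Fin 2)) :=
  Atom.map_bin _ _ _ _

theorem paramRule_satBy {p : T.Label A} {κ : T.Kind A} {x x' : T.Param A}
    {v : Fin (paramRule p κ x x').body.n → M} :
    (paramRule p κ x x').body.SatBy J v ↔ childAtom p κ (v (0 : Fin 3)) (v (1 : Fin 3)) ∈ J ∧
      paramAtom x' (v (2 : Fin 3)) (v (0 : Fin 3)) ∈ J := by
  have key : ∀ w : Fin 3 → M,
      (∀ c ∈ [childAtom p κ (0 : Fin 3) 1, paramAtom x' 2 0], c.map w ∈ J) ↔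
        childAtom p κ (w 0) (w 1) ∈ J ∧ paramAtom x' (w 2) (w 0) ∈ J := by simp
  exact key v

theorem paramRule_head (p : T.Label A) (κ : T.Kind A) (x x' : T.Param A)
    (v : Fin (paramRule p κ x x').body.n → M) :
    (paramRule p κ x x').head.map v = paramAtom x (v (2 : Fin 3)) (v (1 : Fin 3)) :=
  Atom.map_bin _ _ _ _

end

variable (T A) in
/-- The TGDs of the binary program. -/
def treeTGDs : Set (TGD (T.treeSig A)) :=
  {t | (∃ b, t = baseTGD b) ∨ ∃ p κ, Applicable κ p ∧ t = childTGD p κ}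

/-! The views. -/

open Classical in
/-- The variable that stands for the element at a position of the bag of `0`. -/
noncomputable def viewVar (p : T.Label A) {k : ℕ} (x : Fin k → T.Slot A) (i : Fin k) : Fin (k + 1) :=
  if IsSelf p (x i) then 0 else i.succ

-- At a self position the answer variable is `0`, and the variable `i.succ` is idle; the label atom
-- only makes it occur.
open Classical in
noncomputable def viewAtom (p : T.Label A) {k : ℕ} (x : Fin k → T.Slot A) (i : Fin k) :
    Atom (T.treeSig A) (Fin (k + 1)) :=
  if IsSelf p (x i) then labelAtom p i.succ
  else (x i).elim (labelAtom p i.succ) fun z => paramAtom z i.succ 0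

theorem viewAtom_of_isSelf {p : T.Label A} {k : ℕ} {x : Fin k → T.Slot A} {i : Fin k}
    (h : IsSelf p (x i)) : viewAtom p x i = labelAtom p i.succ :=
  if_pos h

theorem viewAtom_of_eq_some {p : T.Label A} {k : ℕ} {x : Fin k → T.Slot A} {i : Fin k}
    {z : T.Param A} (h : ¬ IsSelf p (x i)) (hx : x i = some z) :
    viewAtom p x i = paramAtom z i.succ 0 := by
  rw [viewAtom, if_neg h, hx]
  rfl

theorem exists_eq_some_of_not_isSelf {p : T.Label A} {l : T.Slot A} (h : ¬ IsSelf p l) :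
    ∃ z, l = some z := by
  cases l with
  | none => exact absurd trivial h
  | some z => exact ⟨z, rfl⟩

theorem exists_viewAtom_args (p : T.Label A) {k : ℕ} (x : Fin k → T.Slot A) (i : Fin k) :
    ∃ j, (viewAtom p x i).args j = i.succ := by
  by_cases h : IsSelf p (x i)
  · rw [viewAtom_of_isSelf h]
    exact ⟨⟨0, Nat.one_pos⟩, rfl⟩
  · obtain ⟨z, hz⟩ := exists_eq_some_of_not_isSelf h
    rw [viewAtom_of_eq_some h hz]
    exact ⟨⟨0, Nat.two_pos⟩, rfl⟩

/-- The atom with the arguments at the given positions belongs to the label of an element. -/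
noncomputable def viewQuery (p : T.Label A) {k : ℕ} (x : Fin k → T.Slot A) : AnswerCQ (T.treeSig A) k where
  query := ⟨k + 1, labelAtom p 0 :: List.ofFn (viewAtom p x), fun i => by
    refine Fin.cases ?_ (fun i => ?_) i
    · exact ⟨_, List.mem_cons_self, ⟨0, Nat.one_pos⟩, rfl⟩
    · exact ⟨viewAtom p x i, List.mem_cons_of_mem _ (List.mem_ofFn.2 ⟨i, rfl⟩),
        exists_viewAtom_args p x i⟩⟩
  out := viewVar p x

/-! ### The binary program, its models and its views. -/

section

variable [Finite A]

/-- The datalog rules of the binary program. -/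
def treeRules (D : Set (Atom S A)) : Set (DatalogRule (T.treeSig A)) :=
  {r | (∃ a b, rank (some a) < rank b ∧ r = orderRule a b) ∨ r = rootRule D ∨
    (∃ p κ, r = labelRule p κ) ∨
    (∃ p κ x, IsSelf p (κ.2 x) ∧ r = selfRule p κ x) ∨
    ∃ p κ x x', ¬ IsSelf p (κ.2 x) ∧ κ.2 x = some x' ∧ r = paramRule p κ x x'}

/-- The meaning of the rules and of the TGDs of the binary program. -/
structure IsTreeModel (D : Set (Atom S A)) {M : Type} (J : Set (Atom (T.treeSig A) M)) :
    Prop where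
  base : ∀ b, ∃ y, baseAtom b y ∈ J
  child : ∀ p κ u, Applicable κ p → labelAtom p u ∈ J → ∃ y, childAtom p κ u y ∈ J
  order : ∀ a b x y, rank (some a) < rank b → baseAtom (some a) x ∈ J → baseAtom b y ∈ J →
    paramAtom (Sum.inl a) x y ∈ J
  root : ∀ y, baseAtom none y ∈ J → labelAtom (rootLabel D) y ∈ J
  label : ∀ p κ u y, childAtom p κ u y ∈ J → labelAtom (stepLabel κ p) y ∈ J
  self : ∀ p κ x u y, IsSelf p (κ.2 x) → childAtom p κ u y ∈ J → paramAtom x u y ∈ J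
  param : ∀ p κ x x' u y d, ¬ IsSelf p (κ.2 x) → κ.2 x = some x' → childAtom p κ u y ∈ J →
    paramAtom x' d u ∈ J → paramAtom x d y ∈ J

/-- The relations on the tuples of elements of a model of the original program. -/
def TupleHolds (D : Set (Atom S A)) {M : Type} (I : Set (Atom S M)) (ι : A → M) :
    (R : (T.treeSig A).Rel) → (Fin ((T.treeSig A).arity R) → T.Slot A → M) → Prop
  | .base b, x => (∀ a, x ⟨0, Nat.one_pos⟩ (some (Sum.inl a)) = ι a) ∧
      (∀ a, b = some a → x ⟨0, Nat.one_pos⟩ none = ι a) ∧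
      (b = none → Fits (rootLabel D) I (x ⟨0, Nat.one_pos⟩))
  | .label p, x => Fits p I (x ⟨0, Nat.one_pos⟩)
  | .param z, x => x ⟨0, Nat.two_pos⟩ none = x ⟨1, Nat.one_lt_two⟩ (some z)
  | .child p κ, x => Fits p I (x ⟨0, Nat.two_pos⟩) ∧
      (∀ z, x ⟨1, Nat.one_lt_two⟩ (some z) = x ⟨0, Nat.two_pos⟩ (κ.2 z)) ∧
      Fits (stepLabel κ p) I (x ⟨1, Nat.one_lt_two⟩)

variable (T) in
/-- The model of the binary program that consists of the tuples of elements of a model of the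
original program. -/
def tupleModel (D : Set (Atom S A)) {M : Type} (I : Set (Atom S M)) (ι : A → M) :
    Set (Atom (T.treeSig A) (T.Slot A → M)) :=
  {f | TupleHolds D I ι f.rel f.args}

/-- A tuple plays the part of a bag, with its value at `none` as the bag's own element. The witness
at the root is the root bag read in `M`, with a filler for the root element. -/
theorem isTreeModel_tupleModel {D : Set (Atom S A)} {M : Type} [Nonempty M] {I : Set (Atom S M)}
    {ι : A → M} (hD : ∀ a ∈ D, a.map ι ∈ I) (hI : T.TrueIn I) :
    T.IsTreeModel D (T.tupleModel D I ι) where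
  base b := by
    let g : T.Elem A → M := Sum.elim ι fun _ => Classical.arbitrary M
    cases b with
    | none =>
      refine ⟨fun l => g (bag [] l), fun a => rfl, fun a ha => by simp at ha, fun _ => ?_⟩
      refine Fits.closeLabel ⟨fun l l' h => congrArg g h, ?_⟩ hI
      rintro _ ⟨a, ha, rfl⟩
      exact hD a ha
    | some a =>
      exact ⟨fun l => l.elim (ι a) fun x => g (bag [] (some x)), fun a => rfl,
        fun a ha => congrArg ι (Option.some_injective _ ha), fun h => by simp at h⟩
  child p κ u hκ hu := by
    obtain ⟨y, hy⟩ := Fits.exists_step hu hI hκ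
    exact ⟨_, hu, fun z => rfl, hy⟩
  order a b x y hab hx hy := (hx.2.1 a rfl).trans (hy.1 a).symm
  root y hy := hy.2.2 rfl
  label p κ u y hy := hy.2.2
  self p κ x u y hx hy := by
    refine Eq.trans ?_ (hy.2.1 x).symm
    change u none = u (κ.2 x)
    cases hs : κ.2 x with
    | none => rfl
    | some x' =>
      rw [hs] at hx
      exact (hy.1.1 _ _ hx).symm
  param p κ x x' u y d hx hx' hy hd := by
    refine Eq.trans (hd : d none = u (some x')) ((hy.2.1 x).trans ?_).symm
    rw [hx']
    rfl

variable [Finite S.Rel]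

theorem finite_treeRules (D : Set (Atom S A)) : (T.treeRules D).Finite := by
  refine ((Set.finite_range fun q : A × Option A => orderRule (T := T) q.1 q.2).union
    ((Set.finite_singleton (rootRule (T := T) D)).union
    ((Set.finite_range fun q : T.Label A × T.Kind A => labelRule q.1 q.2).union
    ((Set.finite_range fun q : T.Label A × T.Kind A × T.Param A =>
      selfRule q.1 q.2.1 q.2.2).union
    (Set.finite_range fun q : T.Label A × T.Kind A × T.Param A × T.Param A =>
      paramRule q.1 q.2.1 q.2.2.1 q.2.2.2))))).subset ?_
  rintro r (⟨a, b, -, rfl⟩ | rfl | ⟨p, κ, rfl⟩ | ⟨p, κ, x, -, rfl⟩ | ⟨p, κ, x, x', -, -, rfl⟩)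
  · exact Or.inl ⟨(a, b), rfl⟩
  · exact Or.inr (Or.inl rfl)
  · exact Or.inr (Or.inr (Or.inl ⟨(p, κ), rfl⟩))
  · exact Or.inr (Or.inr (Or.inr (Or.inl ⟨(p, κ, x), rfl⟩)))
  · exact Or.inr (Or.inr (Or.inr (Or.inr ⟨(p, κ, x, x'), rfl⟩)))

variable (T A) in
theorem finite_treeTGDs : (T.treeTGDs A).Finite := by
  refine ((Set.finite_range (baseTGD (T := T) (A := A))).union
    (Set.finite_range fun q : T.Label A × T.Kind A => childTGD q.1 q.2)).subset ?_
  rintro t (⟨b, rfl⟩ | ⟨p, κ, -, rfl⟩)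
  · exact Or.inl ⟨b, rfl⟩
  · exact Or.inr ⟨(p, κ), rfl⟩

variable (T) in
/-- The binary program. -/
noncomputable def treeTheory (D : Set (Atom S A)) : Theory (T.treeSig A) where
  rules := (T.finite_treeRules D).toFinset
  tgds := (T.finite_treeTGDs A).toFinset

theorem treeTheory_trueIn_iff {D : Set (Atom S A)} {M : Type} {J : Set (Atom (T.treeSig A) M)} :
    (T.treeTheory D).TrueIn J ↔ T.IsTreeModel D J := by
  have hr : ∀ r, r ∈ (T.treeTheory D).rules ↔ r ∈ T.treeRules D := fun r =>
    (T.finite_treeRules D).mem_toFinset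
  have ht : ∀ t, t ∈ (T.treeTheory D).tgds ↔ t ∈ T.treeTGDs A := fun t =>
    (T.finite_treeTGDs A).mem_toFinset
  constructor
  · rintro ⟨hrules, htgds⟩
    refine ⟨fun b => ?_, fun p κ u hκ hu => ?_, fun a b x y hab hx hy => ?_, fun y hy => ?_,
      fun p κ u y hy => ?_, fun p κ x u y hx hy => ?_, fun p κ x x' u y d hx hx' hy hd => ?_⟩
    · exact htgds _ ((ht _).2 (Or.inl ⟨b, rfl⟩)) (fun i : Fin 0 => i.elim0) fun a ha =>
        absurd ha List.not_mem_nil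
    · obtain ⟨y, hy⟩ := htgds _ ((ht _).2 (Or.inr ⟨p, κ, hκ, rfl⟩)) (fun _ => u)
        (childTGD_satBy.2 hu)
      rw [childTGD_headWith] at hy
      exact ⟨y, hy⟩
    · have := hrules _ ((hr _).2 (Or.inl ⟨a, b, hab, rfl⟩)) ![x, y] (orderRule_satBy.2 ⟨hx, hy⟩)
      exact (congrArg (· ∈ J) (orderRule_head a b ![x, y])).mp this
    · exact hrules _ ((hr _).2 (Or.inr (Or.inl rfl))) (fun _ => y) (rootRule_satBy.2 hy)
    · exact hrules _ ((hr _).2 (Or.inr (Or.inr (Or.inl ⟨p, κ, rfl⟩)))) ![u, y]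
        (childQuery_satBy.2 hy)
    · have := hrules _ ((hr _).2 (Or.inr (Or.inr (Or.inr (Or.inl ⟨p, κ, x, hx, rfl⟩))))) ![u, y]
        (childQuery_satBy.2 hy)
      exact (congrArg (· ∈ J) (selfRule_head p κ x ![u, y])).mp this
    · have := hrules _
        ((hr _).2 (Or.inr (Or.inr (Or.inr (Or.inr ⟨p, κ, x, x', hx, hx', rfl⟩))))) ![u, y, d]
        (paramRule_satBy.2 ⟨hy, hd⟩)
      exact (congrArg (· ∈ J) (paramRule_head p κ x x' ![u, y, d])).mp this
  · intro h
    refine ⟨fun r hr' v hv => ?_, fun t ht' v hv => ?_⟩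
    · rcases (hr r).1 hr' with ⟨a, b, hab, rfl⟩ | rfl | ⟨p, κ, rfl⟩ | ⟨p, κ, x, hx, rfl⟩ |
        ⟨p, κ, x, x', hx, hx', rfl⟩
      · rw [orderRule_satBy] at hv
        rw [orderRule_head]
        exact h.order a b _ _ hab hv.1 hv.2
      · exact h.root _ (rootRule_satBy.1 hv)
      · exact h.label _ _ _ _ (childQuery_satBy.1 hv)
      · rw [selfRule_head]
        exact h.self _ _ x _ _ hx (childQuery_satBy.1 hv)
      · rw [paramRule_satBy] at hv
        rw [paramRule_head]
        exact h.param _ _ x x' _ _ _ hx hx' hv.1 hv.2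
    · rcases (ht t).1 ht' with ⟨b, rfl⟩ | ⟨p, κ, hκ, rfl⟩
      · exact h.base b
      · obtain ⟨y, hy⟩ := h.child p κ _ hκ (childTGD_satBy.1 hv)
        refine ⟨y, ?_⟩
        rwa [childTGD_headWith]

variable (T A) in
noncomputable def treeViews : Views S (T.treeSig A) := fun R =>
  (Set.toFinite {q : T.Label A × (Fin (S.arity R) → T.Slot A) |
    (⟨R, q.2⟩ : Atom S (T.Slot A)) ∈ q.1.2}).toFinset.toList.map fun q => viewQuery q.1 q.2

theorem mem_treeViews_apply_iff {M : Type} {J : Set (Atom (T.treeSig A) M)} {f : Atom S M} :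
    f ∈ (T.treeViews A).apply J ↔ ∃ (p : T.Label A) (x : Fin (S.arity f.rel) → T.Slot A),
      ⟨f.rel, x⟩ ∈ p.2 ∧ ∃ y, labelAtom p y ∈ J ∧ ∀ i, IsSelf p (x i) ∧ f.args i = y ∨
        ∃ z, ¬ IsSelf p (x i) ∧ x i = some z ∧ paramAtom z (f.args i) y ∈ J := by
  constructor
  · rintro ⟨q, hq, v, hv, hf⟩
    obtain ⟨⟨p, x⟩, hpx, rfl⟩ := List.mem_map.1 hq
    rw [Finset.mem_toList, Set.Finite.mem_toFinset] at hpx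
    let w : Fin (S.arity f.rel + 1) → M := v
    refine ⟨p, x, hpx, w 0, hv _ List.mem_cons_self, fun i => ?_⟩
    have hi : (viewAtom p x i).map w ∈ J :=
      hv (viewAtom p x i) (List.mem_cons_of_mem _ (List.mem_ofFn.2 ⟨i, rfl⟩))
    have hfi : f.args i = w (viewVar p x i) := hf i
    by_cases h : IsSelf p (x i)
    · rw [viewVar, if_pos h] at hfi
      exact Or.inl ⟨h, hfi⟩
    · obtain ⟨z, hz⟩ := exists_eq_some_of_not_isSelf h
      rw [viewVar, if_neg h] at hfi
      rw [viewAtom_of_eq_some h hz, Atom.map_bin] at hi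
      rw [hfi]
      exact Or.inr ⟨z, h, hz, hi⟩
  · rintro ⟨p, x, hpx, y, hy, hf⟩
    let w : Fin (S.arity f.rel + 1) → M := Fin.cons y fun i => f.args i
    refine ⟨viewQuery p x, List.mem_map.2 ⟨(p, x), ?_, rfl⟩, w, ?_, fun i => ?_⟩
    · rw [Finset.mem_toList, Set.Finite.mem_toFinset]
      exact hpx
    · intro a ha
      rcases List.mem_cons.1 ha with rfl | ha
      · exact hy
      · obtain ⟨i, rfl⟩ := List.mem_ofFn.1 ha
        change (viewAtom p x i).map w ∈ J
        have hw : w i.succ = f.args i := rfl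
        rcases hf i with ⟨h, hi⟩ | ⟨z, h, hx, hi⟩
        · rw [viewAtom_of_isSelf h, Atom.map_un, hw, hi]
          exact hy
        · rw [viewAtom_of_eq_some h hx, Atom.map_bin]
          exact hi
    · change f.args i = w (viewVar p x i)
      rcases hf i with ⟨h, hi⟩ | ⟨z, h, hx, hi⟩
      · rw [viewVar, if_pos h]
        exact hi
      · rw [viewVar, if_neg h]
        rfl

/-- The tree maps to the view of each model of the binary program. -/
theorem exists_hom_of_isTreeModel {D : Set (Atom S A)} {M : Type} {J : Set (Atom (T.treeSig A) M)}
    (hJ : T.IsTreeModel D J) :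
    ∃ h : T.Elem A → M, ∀ a ∈ T.tree D, a.map h ∈ (T.treeViews A).apply J := by
  classical
  choose β hβ using hJ.base
  have hex : ∀ p κ u, ∃ y, Applicable κ p → labelAtom p u ∈ J → childAtom p κ u y ∈ J := by
    intro p κ u
    by_cases h : Applicable κ p ∧ labelAtom p u ∈ J
    · obtain ⟨y, hy⟩ := hJ.child p κ u h.1 h.2
      exact ⟨y, fun _ _ => hy⟩
    · exact ⟨u, fun h₁ h₂ => absurd ⟨h₁, h₂⟩ h⟩
  choose next hnext using hex
  -- Follows the chosen witnesses along the path, starting from the one named as the root.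
  let θ : List (T.Kind A) → M := fun e => List.rec (β none) (fun κ u m => next (label D u) κ m) e
  let h : T.Elem A → M := Sum.elim (fun a => β (some a)) θ
  have key : ∀ e, IsBag D e → labelAtom (label D e) (θ e) ∈ J ∧
      ∀ x, ¬ IsSelf (label D e) (some x) → paramAtom x (h (bag e (some x))) (θ e) ∈ J := by
    intro e
    induction e with
    | nil =>
      refine fun _ => ⟨hJ.root _ (hβ none), fun x hx => ?_⟩
      rw [isSelf_label_iff] at hx
      rcases x with a | q
      · exact hJ.order a none _ _ (rank_some_lt a) (hβ _) (hβ _)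
      · exact absurd rfl hx
    | cons κ u ih =>
      rintro ⟨hκ, hu⟩
      have hchild := hnext _ _ _ hκ (ih hu).1
      refine ⟨hJ.label _ _ _ _ hchild, fun x hx => ?_⟩
      rw [bag_cons_some]
      by_cases hs : IsSelf (label D u) (κ.2 x)
      · rw [(isSelf_label_iff D u _).1 hs]
        exact hJ.self _ _ _ _ _ hs hchild
      · cases hx' : κ.2 x with
        | none => rw [hx'] at hs; exact absurd trivial hs
        | some x' =>
          refine hJ.param _ _ _ x' _ _ _ hs hx' hchild ?_
          rw [hx'] at hs
          exact (ih hu).2 x' hs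
  refine ⟨h, ?_⟩
  rintro _ ⟨e, he, a, ha, rfl⟩
  rw [mem_treeViews_apply_iff]
  refine ⟨label D e, a.args, ha, θ e, (key e he).1, fun i => ?_⟩
  change _ ∧ h (bag e (a.args i)) = _ ∨ ∃ z, _ ∧ _ ∧ paramAtom z (h (bag e (a.args i))) _ ∈ J
  by_cases hs : IsSelf (label D e) (a.args i)
  · exact Or.inl ⟨hs, by rw [(isSelf_label_iff D e _).1 hs]; rfl⟩
  · cases hx : a.args i with
    | none => rw [hx] at hs; exact absurd trivial hs
    | some z =>
      rw [hx] at hs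
      exact Or.inr ⟨z, hs, rfl, (key e he).2 z hs⟩

/-- Sending a tuple to its own element undoes the encoding: parameter edges say precisely which own
elements fill the positions of a tuple that realizes `p`. -/
theorem map_mem_of_mem_views_tupleModel {D : Set (Atom S A)} {M : Type} {I : Set (Atom S M)}
    {ι : A → M} : ∀ f ∈ (T.treeViews A).apply (T.tupleModel D I ι), f.map (fun q => q none) ∈ I := by
  intro f hf
  obtain ⟨p, x, hpx, y, hy, hf⟩ := mem_treeViews_apply_iff.1 hf
  have hy' : Fits p I y := hy
  convert hy'.2 _ hpx using 1
  refine congrArg (Atom.mk f.rel) (funext fun i => ?_)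
  rcases hf i with ⟨hs, hi⟩ | ⟨z, -, hx, hi⟩
  · change f.args i none = y (x i)
    rw [hi]
    cases hx : x i with
    | none => rfl
    | some z =>
      rw [hx] at hs
      exact (hy'.1 _ _ hs).symm
  · change f.args i none = y (x i)
    rw [hx]
    exact hi

/-- A model of the original program gives a model of the binary program, whose view satisfies no
more queries. -/
theorem exists_isTreeModel {D : Set (Atom S A)} {M : Type} {I : Set (Atom S M)}
    (hD : Contains I D) (hI : T.TrueIn I) :
    ∃ J : Set (Atom (T.treeSig A) (T.Slot A → Option M)), T.IsTreeModel D J ∧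
      ∀ Φ : CQ S, Φ.Holds ((T.treeViews A).apply J) → Φ.Holds I := by
  obtain ⟨ι, hι⟩ := hD.image_some
  exact ⟨T.tupleModel D _ ι, isTreeModel_tupleModel hι hI.image_some, fun Φ hΦ =>
    CQ.holds_of_holds_some (hΦ.map _ map_mem_of_mem_views_tupleModel)⟩

/-! ### Equivalence of the entailments, and finite controllability. -/

theorem entails_of_holds_tree {D : Set (Atom S A)} {Φ : CQ S} (h : Φ.Holds (T.tree D)) :
    T.Entails D Φ := by
  intro M I hD hI
  obtain ⟨J, hJ, hΦ⟩ := exists_isTreeModel hD hI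
  obtain ⟨f, hf⟩ := exists_hom_of_isTreeModel hJ
  exact hΦ Φ (h.map f hf)

/-- Guarded programs are finitely controllable. -/
theorem IsGuarded.isFC (hT : T.IsGuarded) : T.IsFC := by
  intro A _ D Φ h
  by_contra hcon
  refine h (entails_of_holds_tree (holds_tree_of_forall_finite hT fun M hM I hD hI => ?_))
  by_contra hΦ
  exact hcon ⟨M, hM, I, hD, hI, hΦ⟩

/-- The forward direction passes through finite models: the folded tree shows that `Φ` holds in the
tree, which maps into every view. That the tree itself is a model is never needed. -/
theorem entails_iff_views (hT : T.IsGuarded) (D : Set (Atom S A)) (Φ : CQ S) :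
    T.Entails D Φ ↔ ∀ (M : Type) (J : Set (Atom (T.treeSig A) M)), (T.treeTheory D).TrueIn J →
      Φ.Holds ((T.treeViews A).apply J) := by
  refine ⟨fun h M J hJ => ?_, fun h M I hD hI => ?_⟩
  · obtain ⟨f, hf⟩ := exists_hom_of_isTreeModel (treeTheory_trueIn_iff.1 hJ)
    exact (holds_tree_of_forall_finite hT fun M _ I hD hI => h M I hD hI).map f hf
  · obtain ⟨J, hJ, hΦ⟩ := exists_isTreeModel hD hI
    exact hΦ Φ (h _ J (treeTheory_trueIn_iff.2 hJ))

/-- The tuples over a finite model are finite in number, so `exists_isTreeModel` stays within finite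
structures. -/
theorem finEntails_iff_views (hT : T.IsGuarded) (D : Set (Atom S A)) (Φ : CQ S) :
    T.FinEntails D Φ ↔ ∀ (M : Type) [Finite M] (J : Set (Atom (T.treeSig A) M)),
      (T.treeTheory D).TrueIn J → Φ.Holds ((T.treeViews A).apply J) := by
  refine ⟨fun h M _ J hJ => ?_, fun h M _ I hD hI => ?_⟩
  · obtain ⟨f, hf⟩ := exists_hom_of_isTreeModel (treeTheory_trueIn_iff.1 hJ)
    exact (holds_tree_of_forall_finite hT h).map f hf
  · obtain ⟨J, hJ, hΦ⟩ := exists_isTreeModel hD hI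
    exact hΦ Φ (h _ J (treeTheory_trueIn_iff.2 hJ))

theorem holds_chase_iff_views (hT : T.IsGuarded) (D : Set (Atom S A)) (Φ : CQ S) :
    Φ.Holds (T.chase D) ↔ Φ.Holds ((T.treeViews A).apply (T.treeTheory D).chaseEmpty) := by
  rw [← entails_iff_chase, entails_iff_views hT]
  refine ⟨fun h => h _ _ (chase_trueIn _ _), fun h M J hJ => ?_⟩
  obtain ⟨y, -⟩ := (treeTheory_trueIn_iff.1 hJ).base none
  have : Nonempty M := ⟨y⟩
  exact h.map _ (Views.map_mem_apply _ _
    (chase_interp (f := Empty.elim) (fun a ha => ha.elim) hJ))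

end

end Theory

/-- A measure of the depth of the elements of the chase. -/
def ChaseElem.weight {S : Signature} {A : Type} (f : TGD S → ℕ) : ChaseElem S A → ℕ
  | .base _ => 0
  | .witness t v => f t + ∑ i, ((v i).weight f + 1)

namespace Theory

variable {S : Signature} {T : Theory S} {A : Type}

/-! The chase of the binary program is a very treelike DAG. -/

/-- The element of the chase that stands for an element of the instance, or for the root. -/
def baseElem (b : Option A) : ChaseElem (T.treeSig A) Empty :=
  .witness (baseTGD b) fun i : Fin 0 => i.elim0

/-- The child of an element of the chase. -/
def childElem (p : T.Label A) (κ : T.Kind A) (u : ChaseElem (T.treeSig A) Empty) :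
    ChaseElem (T.treeSig A) Empty :=
  .witness (childTGD p κ) fun _ => u

theorem baseElem_ne_childElem {b : Option A} {p : T.Label A} {κ : T.Kind A}
    {u : ChaseElem (T.treeSig A) Empty} : baseElem b ≠ childElem p κ u := by
  intro h
  injection h with h
  have : TreeRel.base b = TreeRel.child p κ := congrArg (fun t => t.head.rel) h
  cases this

theorem childElem_inj {p p' : T.Label A} {κ κ' : T.Kind A}
    {u u' : ChaseElem (T.treeSig A) Empty} (h : childElem p κ u = childElem p' κ' u') :
    p = p' ∧ κ = κ' ∧ u = u' := by
  injection h with h h'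
  have : TreeRel.child p κ = TreeRel.child p' κ' := congrArg (fun t => t.head.rel) h
  injection this with hp hκ
  subst hp hκ
  exact ⟨rfl, rfl, congrFun h' (0 : Fin 1)⟩

section

variable [Finite A]

/-- The rank of the base element that a TGD creates. -/
noncomputable def tgdWeight (t : TGD (T.treeSig A)) : ℕ :=
  match t.head.rel with
  | .base b => rank b
  | _ => 0

noncomputable abbrev treeWeight : ChaseElem (T.treeSig A) Empty → ℕ :=
  ChaseElem.weight tgdWeight

theorem treeWeight_baseElem (b : Option A) : treeWeight (baseElem (T := T) b) = rank b := by
  change rank b + ∑ i : Fin 0, _ = rank b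
  simp

theorem lt_treeWeight_childElem (p : T.Label A) (κ : T.Kind A)
    (u : ChaseElem (T.treeSig A) Empty) : treeWeight u < treeWeight (childElem p κ u) := by
  change _ < 0 + ∑ i : Fin 1, (treeWeight u + 1)
  simp

variable [Finite S.Rel] {D : Set (Atom S A)}

/-- The origin of each atom. Witnesses are named by their TGD and its arguments, so a child
determines its label, kind and parent (`childElem_inj`); the next lemmas read the edges off from
this. -/
theorem chaseEmpty_treeTheory_cases {f : Atom (T.treeSig A) (ChaseElem (T.treeSig A) Empty)}
    (hf : f ∈ (T.treeTheory D).chaseEmpty) :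
    (∃ a b x y, rank (some a) < rank b ∧ baseAtom (some a) x ∈ (T.treeTheory D).chaseEmpty ∧
      baseAtom b y ∈ (T.treeTheory D).chaseEmpty ∧ f = paramAtom (Sum.inl a) x y) ∨
    (∃ p x, f = labelAtom p x) ∨
    (∃ p κ x u y, IsSelf p (κ.2 x) ∧ childAtom p κ u y ∈ (T.treeTheory D).chaseEmpty ∧
      f = paramAtom x u y) ∨
    (∃ p κ x x' u y d, ¬ IsSelf p (κ.2 x) ∧ κ.2 x = some x' ∧
      childAtom p κ u y ∈ (T.treeTheory D).chaseEmpty ∧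
      paramAtom x' d u ∈ (T.treeTheory D).chaseEmpty ∧ f = paramAtom x d y) ∨
    (∃ b, f = baseAtom b (baseElem b)) ∨
    ∃ p κ u, f = childAtom p κ u (childElem p κ u) := by
  rcases chaseEmpty_cases hf with ⟨r, hr, v, hv, rfl⟩ | ⟨t, ht, v, hv, rfl⟩
  · rcases (T.finite_treeRules D).mem_toFinset.1 hr with ⟨a, b, hab, rfl⟩ | rfl | ⟨p, κ, rfl⟩ |
      ⟨p, κ, x, hx, rfl⟩ | ⟨p, κ, x, x', hx, hx', rfl⟩
    · rw [orderRule_satBy] at hv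
      exact Or.inl ⟨a, b, _, _, hab, hv.1, hv.2, orderRule_head a b v⟩
    · exact Or.inr (Or.inl ⟨_, _, rootRule_head D v⟩)
    · exact Or.inr (Or.inl ⟨_, _, labelRule_head p κ v⟩)
    · exact Or.inr (Or.inr (Or.inl ⟨p, κ, x, _, _, hx, childQuery_satBy.1 hv,
        selfRule_head p κ x v⟩))
    · rw [paramRule_satBy] at hv
      exact Or.inr (Or.inr (Or.inr (Or.inl ⟨p, κ, x, x', _, _, _, hx, hx', hv.1, hv.2,
        paramRule_head p κ x x' v⟩)))
  · rcases (T.finite_treeTGDs A).mem_toFinset.1 ht with ⟨b, rfl⟩ | ⟨p, κ, -, rfl⟩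
    · refine Or.inr (Or.inr (Or.inr (Or.inr (Or.inl ⟨b, ?_⟩))))
      rw [baseTGD_headWith, baseElem]
      congr
      exact funext fun i : Fin 0 => i.elim0
    · refine Or.inr (Or.inr (Or.inr (Or.inr (Or.inr ⟨p, κ, v (0 : Fin 1), ?_⟩))))
      rw [childTGD_headWith, childElem]
      congr
      exact funext fun i : Fin 1 => congrArg v (Subsingleton.elim i 0)

theorem eq_baseElem {b : Option A} {e : ChaseElem (T.treeSig A) Empty}
    (h : baseAtom b e ∈ (T.treeTheory D).chaseEmpty) : e = baseElem b := by
  rcases chaseEmpty_treeTheory_cases h with ⟨_, _, _, _, _, _, _, h⟩ | ⟨_, _, h⟩ |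
    ⟨_, _, _, _, _, _, _, h⟩ | ⟨_, _, _, _, _, _, _, _, _, _, _, h⟩ | ⟨b', h⟩ | ⟨_, _, _, h⟩
  · cases congrArg Atom.rel h
  · cases congrArg Atom.rel h
  · cases congrArg Atom.rel h
  · cases congrArg Atom.rel h
  · obtain ⟨hb, he⟩ := Atom.un_inj rfl h
    injection hb with hb
    rw [he, hb]
  · cases congrArg Atom.rel h

theorem eq_childElem {p : T.Label A} {κ : T.Kind A} {u e : ChaseElem (T.treeSig A) Empty}
    (h : childAtom p κ u e ∈ (T.treeTheory D).chaseEmpty) : e = childElem p κ u := by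
  rcases chaseEmpty_treeTheory_cases h with ⟨_, _, _, _, _, _, _, h⟩ | ⟨_, _, h⟩ |
    ⟨_, _, _, _, _, _, _, h⟩ | ⟨_, _, _, _, _, _, _, _, _, _, _, h⟩ | ⟨b', h⟩ | ⟨_, _, _, h⟩
  · cases congrArg Atom.rel h
  · cases congrArg Atom.rel h
  · cases congrArg Atom.rel h
  · cases congrArg Atom.rel h
  · cases congrArg Atom.rel h
  · obtain ⟨hp, hu, he⟩ := Atom.bin_inj rfl h
    injection hp with hp hκ
    rw [he, hp, hκ, hu]

theorem paramAtom_cases {x : T.Param A} {d e : ChaseElem (T.treeSig A) Empty}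
    (h : paramAtom x d e ∈ (T.treeTheory D).chaseEmpty) :
    (∃ a b, x = Sum.inl a ∧ rank (some a) < rank b ∧ d = baseElem (some a) ∧ e = baseElem b) ∨
    ∃ p κ u, e = childElem p κ u ∧ (IsSelf p (κ.2 x) ∧ d = u ∨
      ∃ x', ¬ IsSelf p (κ.2 x) ∧ κ.2 x = some x' ∧
        paramAtom x' d u ∈ (T.treeTheory D).chaseEmpty) := by
  rcases chaseEmpty_treeTheory_cases h with ⟨a, b, y, z, hab, hy, hz, h⟩ | ⟨_, _, h⟩ |
    ⟨p, κ, y, u, z, hx, hz, h⟩ | ⟨p, κ, y, x', u, z, d', hx, hx', hz, hd, h⟩ | ⟨b', h⟩ | ⟨_, _, _, h⟩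
  · obtain ⟨hx, rfl, rfl⟩ := Atom.bin_inj rfl h
    injection hx with hx
    exact Or.inl ⟨a, b, hx, hab, eq_baseElem hy, eq_baseElem hz⟩
  · cases congrArg Atom.rel h
  · obtain ⟨hy, rfl, rfl⟩ := Atom.bin_inj rfl h
    injection hy with hy
    subst hy
    exact Or.inr ⟨p, κ, _, eq_childElem hz, Or.inl ⟨hx, rfl⟩⟩
  · obtain ⟨hy, rfl, rfl⟩ := Atom.bin_inj rfl h
    injection hy with hy
    subst hy
    exact Or.inr ⟨p, κ, _, eq_childElem hz, Or.inr ⟨x', hx, hx', hd⟩⟩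
  · cases congrArg Atom.rel h
  · cases congrArg Atom.rel h

theorem treeWeight_lt_of_paramAtom {x : T.Param A} {d e : ChaseElem (T.treeSig A) Empty}
    (h : paramAtom x d e ∈ (T.treeTheory D).chaseEmpty) : treeWeight d < treeWeight e := by
  induction hn : treeWeight e using Nat.strong_induction_on generalizing x e with
  | _ n ih =>
  subst hn
  rcases paramAtom_cases h with ⟨a, b, -, hab, rfl, rfl⟩ |
    ⟨p, κ, u, rfl, ⟨-, rfl⟩ | ⟨x', -, -, hd⟩⟩
  · rwa [treeWeight_baseElem, treeWeight_baseElem]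
  · exact lt_treeWeight_childElem p κ _
  · exact (ih _ (lt_treeWeight_childElem p κ u) hd rfl).trans (lt_treeWeight_childElem p κ u)

theorem edge_cases {R : (T.treeSig A).Rel} {d e : ChaseElem (T.treeSig A) Empty}
    (h : Edge (T.treeTheory D).chaseEmpty R d e) :
    (∃ p κ, R = TreeRel.child p κ ∧ e = childElem p κ d) ∨
      ∃ x, R = TreeRel.param x ∧ paramAtom x d e ∈ (T.treeTheory D).chaseEmpty := by
  obtain ⟨hR, h⟩ := h
  rcases R with b | p | x | ⟨p, κ⟩
  · exact absurd hR (by norm_num [TreeRel.arity])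
  · exact absurd hR (by norm_num [TreeRel.arity])
  · exact Or.inr ⟨x, rfl, h⟩
  · exact Or.inl ⟨p, κ, rfl, eq_childElem h⟩

theorem treeWeight_lt_of_edge {R : (T.treeSig A).Rel} {d e : ChaseElem (T.treeSig A) Empty}
    (h : Edge (T.treeTheory D).chaseEmpty R d e) : treeWeight d < treeWeight e := by
  rcases edge_cases h with ⟨p, κ, -, rfl⟩ | ⟨x, -, hx⟩
  · exact lt_treeWeight_childElem p κ d
  · exact treeWeight_lt_of_paramAtom hx

/-- A child determines whether its parameter `x` is the parent or is inherited from a fixed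
parameter of the parent; induction on weight settles the second case. -/
theorem paramAtom_unique {x : T.Param A} {d d' e : ChaseElem (T.treeSig A) Empty}
    (h : paramAtom x d e ∈ (T.treeTheory D).chaseEmpty)
    (h' : paramAtom x d' e ∈ (T.treeTheory D).chaseEmpty) : d = d' := by
  induction hn : treeWeight e using Nat.strong_induction_on generalizing x e with
  | _ n ih =>
  subst hn
  rcases paramAtom_cases h with ⟨a, b, rfl, -, rfl, rfl⟩ | ⟨p, κ, u, rfl, hd⟩
  · rcases paramAtom_cases h' with ⟨a', b', ha, -, rfl, -⟩ | ⟨p, κ, u, he, -⟩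
    · rw [Sum.inl_injective ha]
    · exact absurd he baseElem_ne_childElem
  · rcases paramAtom_cases h' with ⟨a', b', -, -, -, he⟩ | ⟨p', κ', u', he, hd'⟩
    · exact absurd he.symm baseElem_ne_childElem
    · obtain ⟨rfl, rfl, rfl⟩ := childElem_inj he
      rcases hd with ⟨hs, rfl⟩ | ⟨x', hs, hx', hd⟩ <;>
        rcases hd' with ⟨hs', rfl⟩ | ⟨x'', hs', hx'', hd'⟩
      · rfl
      · exact absurd hs hs'
      · exact absurd hs' hs
      · obtain rfl : x' = x'' := Option.some_injective _ (hx'.symm.trans hx'')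
        exact ih _ (lt_treeWeight_childElem _ _ _) hd hd' rfl

theorem edge_shape {R : (T.treeSig A).Rel} {d e : ChaseElem (T.treeSig A) Empty}
    (h : Edge (T.treeTheory D).chaseEmpty R d e) :
    (∃ a b, rank (some a) < rank b ∧ d = baseElem (some a) ∧ e = baseElem b) ∨
      ∃ p κ u, e = childElem p κ u ∧ d ∈ preds (T.treeTheory D).chaseEmpty u := by
  rcases edge_cases h with ⟨p, κ, -, he⟩ | ⟨x, -, hx⟩
  · exact Or.inr ⟨p, κ, d, he, Or.inl rfl⟩
  · rcases paramAtom_cases hx with ⟨a, b, -, hab, hd, he⟩ |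
      ⟨p, κ, u, he, ⟨-, rfl⟩ | ⟨x', -, -, hd⟩⟩
    · exact Or.inl ⟨a, b, hab, hd, he⟩
    · exact Or.inr ⟨p, κ, _, he, Or.inl rfl⟩
    · exact Or.inr ⟨p, κ, u, he, Or.inr ⟨TreeRel.param x', rfl, hd⟩⟩

-- Edges increase weight, which excludes cycles. For the clique condition, the predecessors of a
-- base element are named elements, a chain by `orderRule`; those of a child lie in `preds` of its
-- parent (`edge_shape`), so induction applies.
variable (T D) in
theorem isVTDAG_chaseEmpty_treeTheory : IsVTDAG (T.treeTheory D).chaseEmpty where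
  acyclic a ha := by
    have key : ∀ {b}, Relation.TransGen
        (fun d e => ∃ R, Edge (T.treeTheory D).chaseEmpty R d e) a b →
        treeWeight a < treeWeight b := by
      intro b hb
      induction hb with
      | single h =>
        obtain ⟨R, h⟩ := h
        exact treeWeight_lt_of_edge h
      | tail _ h ih =>
        obtain ⟨R, h⟩ := h
        exact ih.trans (treeWeight_lt_of_edge h)
    exact lt_irrefl _ (key ha)
  unique_pred R e d d' h h' := by
    rcases edge_cases h with ⟨p, κ, rfl, he⟩ | ⟨x, rfl, hx⟩
    · rcases edge_cases h' with ⟨p', κ', hR, he'⟩ | ⟨x, hR, -⟩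
      · injection hR with hp hκ
        subst hp hκ
        exact (childElem_inj (he.symm.trans he')).2.2
      · cases hR
    · exact paramAtom_unique hx h'.2
  clique e d hd d' hd' := by
    induction hn : treeWeight e using Nat.strong_induction_on generalizing e with
    | _ n ih =>
    subst hn
    rcases hd with rfl | ⟨R, hR⟩
    · exact Or.inr hd'
    rcases hd' with rfl | ⟨R', hR'⟩
    · exact Or.inl (Or.inr ⟨R, hR⟩)
    rcases edge_shape hR with ⟨a, b, -, rfl, rfl⟩ | ⟨p, κ, u, rfl, hu⟩
    · rcases edge_shape hR' with ⟨a', b', -, rfl, -⟩ | ⟨p, κ, u, he, -⟩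
      · have hmodel := treeTheory_trueIn_iff.1 ((T.treeTheory D).chase_trueIn (∅ : Set (Atom _ Empty)))
        have hbase : ∀ b, baseAtom b (baseElem b) ∈ (T.treeTheory D).chaseEmpty := by
          intro b
          obtain ⟨y, hy⟩ := hmodel.base b
          exact eq_baseElem hy ▸ hy
        rcases lt_trichotomy (rank (some a)) (rank (some a')) with hlt | heq | hlt
        · exact Or.inl (Or.inr ⟨TreeRel.param (Sum.inl a), rfl,
            hmodel.order a (some a') _ _ hlt (hbase _) (hbase _)⟩)
        · exact Or.inl (Or.inl (by rw [eq_of_rank_eq heq]))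
        · exact Or.inr (Or.inr ⟨TreeRel.param (Sum.inl a'), rfl,
            hmodel.order a' (some a) _ _ hlt (hbase _) (hbase _)⟩)
      · exact absurd he baseElem_ne_childElem
    · rcases edge_shape hR' with ⟨a', b', -, -, he⟩ | ⟨p', κ', u', he, hu'⟩
      · exact absurd he.symm baseElem_ne_childElem
      · obtain ⟨rfl, rfl, rfl⟩ := childElem_inj he
        exact ih _ (lt_treeWeight_childElem _ _ _) u hu hu' rfl

end

end Theory

theorem mainTheorem6 (S : Signature) [Finite S.Rel] :
    -- rewriting into a binary program whose chase is a VTDAG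
    (∀ T : Theory S, T.IsGuarded → ∀ (A : Type) [Finite A] (D : Set (Atom S A)),
      ∃ S' : Signature, Finite S'.Rel ∧ S'.IsBinary ∧ ∃ (T' : Theory S') (V : Views S S'),
        IsVTDAG T'.chaseEmpty ∧
        (∀ Φ : CQ S, Φ.Holds (T.chase D) ↔ Φ.Holds (V.apply T'.chaseEmpty)) ∧
        (∀ Φ : CQ S, T.Entails D Φ ↔
          ∀ (M : Type) (J : Set (Atom S' M)), T'.TrueIn J → Φ.Holds (V.apply J)) ∧
        (∀ Φ : CQ S, T.FinEntails D Φ ↔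
          ∀ (M : Type) [Finite M] (J : Set (Atom S' M)), T'.TrueIn J → Φ.Holds (V.apply J))) ∧
    -- datalog rules with unary heads are preserved under conservative quotients
    (∀ (A : Type) (I : Set (Atom S A)) (K : Finset (ℕ × ℕ)) (col : A → K) (n m : ℕ),
      IsConservative n m I col → ∀ r : DatalogRule S, S.arity r.head.rel = 1 → r.body.n ≤ m →
        r.TrueIn I → r.TrueIn (uncolored (quotientStructure n (colored I col)))) ∧
    -- guarded programs are finitely controllable
    (∀ T : Theory S, T.IsGuarded → T.IsFC) := by
  refine ⟨fun T hT A _ D => ?_, fun A I K col n m hc r hr hm hI =>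
    DatalogRule.trueIn_quotient hc r hr hm hI, fun T hT => hT.isFC⟩
  exact ⟨T.treeSig A, inferInstance, Theory.treeSig_isBinary, T.treeTheory D, T.treeViews A,
    T.isVTDAG_chaseEmpty_treeTheory D, Theory.holds_chase_iff_views hT D,
    Theory.entails_iff_views hT D, Theory.finEntails_iff_views hT D⟩
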